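/- Let $(X,\mu)$ be a nonatomic standard probability space and $\Gamma$ a countable group. Let $A(\Gamma,X,\mu)$ be the space of measure-preserving actions $a:\Gamma\curvearrowright(X,\mu)$, where actions that agree modulo $\mu$-null sets are identified, with the topology generated by the maps $a\mapsto\gamma^a\cdot B\in\mathrm{MALG}_\mu$ for $\gamma\in\Gamma$ and $B\subseteq X$ Borel; here $\gamma^a\cdot x=a(\gamma,x)$, and $\mathrm{MALG}_\mu$ is the measure algebra with the metric $d(B,D)=\mu(B\mathbin{\triangle}D)$. The group $\mathrm{Aut}(X,\mu)$ acts on $A(\Gamma,X,\mu)$ by conjugation. For $a,b\in A(\Gamma,X,\mu)$ write $a\preccurlyeq b$ ($a$ is weakly contained in $b$) if $a\in\overline{\mathrm{Aut}(X,\mu)\cdot b}$, and $a\approx b$ (weak equivalence) if $a\preccurlyeq b\preccurlyeq a$. Let $\underline{A}(\Gamma,X,\mu)=A(\Gamma,X,\mu)/{\approx}$ be the space of weak equivalence classes, partially ordered by $\preccurlyeq$. Let $\sigma$ be the quotient topology on $\underline{A}(\Gamma,X,\mu)$. Let $\tau$ be the Abért–Elek topology on $\underline{A}(\Gamma,X,\mu)$: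 the coarsest topology for which, for every finite $\Delta\subseteq\Gamma$ and every $k\ge 1$, the nonempty compact set $$C_{\Delta,k}(a)=\overline{\bigl\{\bigl(\mu(\gamma^a(B_i)\cap B_j)\bigr)_{\gamma\in\Delta;\,i,j<k} : (B_i)_{i<k}\text{ a measurable partition of }X\bigr\}}\subseteq[0,1]^{\Delta\times k\times k}$$ depends continuously on the class of $a$ with respect to the Hausdorff metric. For a topology on a set, the specialization preorder is given by $x\lesssim y\iff x\in\overline{\{y\}}$. The topology is stably compact if every point has a basis of compact neighborhoods and every ultrafilter has a unique greatest limit in the specialization preorder. The patch topology of a stably compact topology is the topology whose closed sets are generated by its closed sets together with its compact sets that are upward-closed in the specialization preorder. The upper topology of a topology with a partial order consists of the upward-closed open sets. By a theorem of Gierz et al., $\sigma'\mapsto(\text{patch topology of }\sigma',\ \text{specialization order of }\sigma')$ is a bijection from the stably compact topologies on a set to the pairs of a compact Hausdorff topology and a partial order closed in it, with inverse $(\tau',\le)\mapsto$ upper topology of $(\tau',\le)$. **Proposition.** The topology $\sigma$ is stably compact; the topology $\tau$ is compact and Polish (in particular Hausdorff), and $\preccurlyeq$ is closed in $\underline{A}(\Gamma,X,\mu)^2$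 for the $\tau$-product topology; and $\sigma$ corresponds to $(\tau,\preccurlyeq)$ under this bijection. That is, the patch topology of $\sigma$ is $\tau$, the specialization order of $\sigma$ is $\preccurlyeq$, and the upper topology of $(\tau,\preccurlyeq)$ is $\sigma$. -/

import Mathlib

open MeasureTheory Set Topology
open scoped symmDiff

namespace WeakEquivalence

section StablyCompact

variable {Y : Type*}

/-- The specialization preorder of a topology `σ`: `x` lies below `y` iff `x` is in the closure
of `{y}`. -/
def SpecLE (σ : TopologicalSpace Y) (x y : Y) : Prop :=
  x ∈ @closure Y σ {y}

/-- `x` is a limit of the ultrafilter `F` with respect to `σ`, and every other limit of `F` lies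
below `x` in the specialization preorder. -/
def IsGreatestLimit (σ : TopologicalSpace Y) (F : Ultrafilter Y) (x : Y) : Prop :=
  (F : Filter Y) ≤ @nhds Y σ x ∧ ∀ y, (F : Filter Y) ≤ @nhds Y σ y → SpecLE σ y x

/-- A topology is stably compact if every point has a basis of compact neighborhoods, and every
ultrafilter has a unique greatest limit in the specialization preorder. -/
structure IsStablyCompact (σ : TopologicalSpace Y) : Prop where
  locallyCompact : @LocallyCompactSpace Y σ
  stronglySober : ∀ F : Ultrafilter Y, ∃! x, IsGreatestLimit σ F x

/-- The patch topology of `σ`: the closed sets are generated by the `σ`-closed sets together with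
the `σ`-compact sets that are upward-closed in the specialization preorder. -/
@[reducible] def patchTopology (σ : TopologicalSpace Y) : TopologicalSpace Y :=
  TopologicalSpace.generateFrom
    {U | IsClosed[σ] Uᶜ ∨
      (@IsCompact Y σ Uᶜ ∧ ∀ x ∈ Uᶜ, ∀ y, SpecLE σ x y → y ∈ Uᶜ)}

/-- The upper topology of a topology `τ` and a partial order: the open sets are the upward-closed
`τ`-open sets. -/
@[reducible] def upperTopology (τ : TopologicalSpace Y) [PartialOrder Y] : TopologicalSpace Y where
  IsOpen U := IsOpen[τ] U ∧ IsUpperSet U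
  isOpen_univ := ⟨@isOpen_univ Y τ, isUpperSet_univ⟩
  isOpen_inter _ _ hU hV := ⟨@IsOpen.inter Y τ _ _ hU.1 hV.1, hU.2.inter hV.2⟩
  isOpen_sUnion _ h :=
    ⟨@isOpen_sUnion Y τ _ fun U hU => (h U hU).1, isUpperSet_sUnion fun U hU => (h U hU).2⟩

end StablyCompact

section Actions

variable {X : Type*} [MeasurableSpace X]

/-- The group of measure-preserving Borel automorphisms of `(X, μ)`. -/
def MPAut (μ : Measure X) : Subgroup (Equiv.Perm X) where
  carrier := {T | MeasurePreserving T μ μ ∧ MeasurePreserving T.symm μ μ}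
  one_mem' := ⟨MeasurePreserving.id μ, MeasurePreserving.id μ⟩
  mul_mem' hS hT := ⟨hS.1.comp hT.1, hT.2.comp hS.2⟩
  inv_mem' hT := ⟨hT.2, hT.1⟩

namespace MPAut

variable {μ : Measure X}

lemma measurableSet_image (T : MPAut μ) {B : Set X} (hB : MeasurableSet B) :
    MeasurableSet (T.1 '' B) := by
  rw [Equiv.image_eq_preimage_symm]
  exact T.2.2.measurable hB

lemma measure_image (T : MPAut μ) {B : Set X} (hB : MeasurableSet B) :
    μ (T.1 '' B) = μ B := by
  rw [Equiv.image_eq_preimage_symm]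
  exact T.2.2.measure_preimage hB.nullMeasurableSet

/-- The image `T(B)` of a measurable set under an automorphism. -/
def image (T : MPAut μ) (B : MeasuredSets μ) : MeasuredSets μ :=
  ⟨T.1 '' B.1, MPAut.measurableSet_image T B.2⟩

lemma edist_image (T : MPAut μ) (B D : MeasuredSets μ) :
    edist (image T B) (image T D) = edist B D := by
  change μ ((T.1 '' B.1) ∆ (T.1 '' D.1)) = μ (B.1 ∆ D.1)
  rw [← Set.image_symmDiff T.1.injective, MPAut.measure_image T (B.2.symmDiff D.2)]

lemma edist_image_eq_zero {S T : MPAut μ} (h : ∀ᵐ x ∂μ, S.1 x = T.1 x) (B : MeasuredSets μ) :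
    edist (image S B) (image T B) = 0 := by
  change μ ((S.1 '' B.1) ∆ (T.1 '' B.1)) = 0
  have hN : μ (toMeasurable μ {x | S.1 x ≠ T.1 x}) = 0 := by
    rw [measure_toMeasurable]; exact h
  have hM := measurableSet_toMeasurable μ {x | S.1 x ≠ T.1 x}
  have hsub := subset_toMeasurable μ {x | S.1 x ≠ T.1 x}
  set N := toMeasurable μ {x | S.1 x ≠ T.1 x}
  refine measure_mono_null (t := S.1 '' N ∪ T.1 '' N) ?_ ?_
  · rintro y (⟨⟨x, hx, rfl⟩, hy⟩ | ⟨⟨x, hx, rfl⟩, hy⟩)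
    · exact Or.inl ⟨x, hsub fun he => hy ⟨x, hx, he.symm⟩, rfl⟩
    · exact Or.inr ⟨x, hsub fun he => hy ⟨x, hx, he⟩, rfl⟩
  · rw [measure_union_null_iff, measure_image _ hM, measure_image _ hM]
    exact ⟨hN, hN⟩

end MPAut

/-- The measure algebra of `μ`: measurable sets modulo null sets, with the metric
`d(B, D) = μ (B ∆ D)`. -/
abbrev MALG (μ : Measure X) : Type _ := SeparationQuotient (MeasuredSets μ)

variable (Γ : Type*) [Group Γ] (μ : Measure X)

/-- Two actions of `Γ` by measure-preserving automorphisms are identified if they agree modulo null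
sets. -/
def aeSetoid : Setoid (Γ →* MPAut μ) where
  r a b := ∀ γ, ∀ᵐ x ∂μ, (a γ).1 x = (b γ).1 x
  iseqv :=
    { refl := fun _ _ => Filter.Eventually.of_forall fun _ => rfl
      symm := fun h γ => (h γ).mono fun _ hx => hx.symm
      trans := fun h h' γ => by
        filter_upwards [h γ, h' γ] with x hx hx'
        exact hx.trans hx' }

/-- The space of measure-preserving actions of `Γ` on `(X, μ)`, modulo null sets. -/
def ActionSpace : Type _ := Quotient (aeSetoid Γ μ)

variable {Γ μ}

namespace ActionSpace

/-- The action `a`, regarded as an element of the space of actions. -/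
def mk (a : Γ →* MPAut μ) : ActionSpace Γ μ := Quotient.mk (aeSetoid Γ μ) a

/-- The map `a ↦ γ^a · B` to the measure algebra. -/
noncomputable def move (γ : Γ) (B : MeasuredSets μ) : ActionSpace Γ μ → MALG μ :=
  Quotient.lift (fun a : Γ →* MPAut μ => SeparationQuotient.mk (MPAut.image (a γ) B)) fun a b h => by
    rw [SeparationQuotient.mk_eq_mk, EMetric.inseparable_iff]
    exact MPAut.edist_image_eq_zero (h γ) B

/-- The topology on the space of actions generated by the maps `a ↦ γ^a · B`, for `γ` in `Γ` and
`B` measurable. -/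
noncomputable instance : TopologicalSpace (ActionSpace Γ μ) :=
  ⨅ (γ : Γ) (B : MeasuredSets μ), TopologicalSpace.induced (move γ B) inferInstance

lemma continuous_move (γ : Γ) (B : MeasuredSets μ) :
    Continuous (move γ B : ActionSpace Γ μ → MALG μ) :=
  continuous_iff_le_induced.2 ((iInf_le _ γ).trans (iInf_le _ B))

/-- Automorphisms act on the space of actions by conjugation: `γ^(T • a) = T ∘ γ^a ∘ T⁻¹`.
Automorphisms that agree almost everywhere act in the same way. -/
instance : MulAction (MPAut μ) (ActionSpace Γ μ) where
  smul T := Quotient.map (fun a : Γ →* MPAut μ => (MulAut.conj T).toMonoidHom.comp a)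
    fun a b h γ => by
      have h1 : ∀ᵐ x ∂μ, (a γ).1 (T.1.symm x) = (b γ).1 (T.1.symm x) :=
        T.2.2.quasiMeasurePreserving.ae (h γ)
      filter_upwards [h1] with x hx
      exact congrArg T.1 hx
  one_smul := by
    rintro ⟨a⟩
    refine congrArg mk (MonoidHom.ext fun γ => ?_)
    change 1 * a γ * 1⁻¹ = a γ
    group
  mul_smul := by
    rintro S T ⟨a⟩
    refine congrArg mk (MonoidHom.ext fun γ => ?_)
    change S * T * a γ * (S * T)⁻¹ = S * (T * a γ * T⁻¹) * S⁻¹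
    group

lemma smul_mk (T : MPAut μ) (a : Γ →* MPAut μ) :
    T • mk a = mk ((MulAut.conj T).toMonoidHom.comp a) := rfl

instance : ContinuousConstSMul (MPAut μ) (ActionSpace Γ μ) where
  continuous_const_smul T := by
    refine continuous_iInf_rng.2 fun γ => continuous_iInf_rng.2 fun B => continuous_induced_rng.2 ?_
    have hT : Continuous (MPAut.image T : MeasuredSets μ → MeasuredSets μ) :=
      Isometry.continuous fun B D => MPAut.edist_image T B D
    have hT' : Continuous (SeparationQuotient.lift (SeparationQuotient.mk ∘ MPAut.image T)
        fun B D h => by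
          rw [Function.comp, Function.comp, SeparationQuotient.mk_eq_mk]
          exact h.map hT : MALG μ → MALG μ) :=
      SeparationQuotient.continuous_lift (SeparationQuotient.continuous_mk.comp hT)
    convert hT'.comp (continuous_move γ (MPAut.image T⁻¹ B)) using 1
    ext ⟨a⟩
    refine congrArg SeparationQuotient.mk (Subtype.ext ?_)
    change (T * a γ * T⁻¹).1 '' B.1 = T.1 '' ((a γ).1 '' (T⁻¹.1 '' B.1))
    rw [← Set.image_comp, ← Set.image_comp]
    rfl

/-- Weak containment: `a ≤ b` iff `a` is in the closure of the conjugacy orbit of `b`. -/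
instance : Preorder (ActionSpace Γ μ) where
  le a b := a ∈ closure (MulAction.orbit (MPAut μ) b)
  le_refl a := subset_closure (MulAction.mem_orbit_self a)
  le_trans a b c hab hbc := by
    refine closure_minimal ?_ isClosed_closure hab
    rintro _ ⟨T, rfl⟩
    refine map_mem_closure (continuous_const_smul T) hbc ?_
    rintro _ ⟨S, rfl⟩
    exact ⟨T * S, mul_smul T S c⟩

lemma le_def {a b : ActionSpace Γ μ} :
    a ≤ b ↔ a ∈ closure (MulAction.orbit (MPAut μ) b) := Iff.rfl

/-- For a finite set `Δ ⊆ Γ`, and the partition of `X` into the sets `B_i = p⁻¹(i)`, `i ≤ k`, the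
family of numbers `μ(γ^a(B_i) ∩ B_j)` for `γ` in `Δ` and `i, j ≤ k`. -/
noncomputable def stat (Δ : Finset Γ) (k : ℕ) (p : {p : X → Fin (k + 1) // Measurable p}) :
    ActionSpace Γ μ → (Δ → Fin (k + 1) → Fin (k + 1) → ℝ) :=
  Quotient.lift
    (fun (a : Γ →* MPAut μ) γ i j => μ.real ((a γ).1 '' (p.1 ⁻¹' {i}) ∩ p.1 ⁻¹' {j}))
    fun a b h => by
      ext γ i j
      have h0 : μ (((a γ).1 '' (p.1 ⁻¹' {i})) ∆ ((b γ).1 '' (p.1 ⁻¹' {i}))) = 0 :=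
        MPAut.edist_image_eq_zero (h γ) ⟨p.1 ⁻¹' {i}, p.2 (measurableSet_singleton i)⟩
      exact measureReal_congr
        ((measure_symmDiff_eq_zero_iff.1 h0).inter (Filter.EventuallyEq.refl _ _))

lemma stat_smul (Δ : Finset Γ) (k : ℕ) (p : {p : X → Fin (k + 1) // Measurable p})
    (T : MPAut μ) (a : ActionSpace Γ μ) :
    stat Δ k p (T • a) = stat Δ k ⟨p.1 ∘ T.1, p.2.comp T.2.1.measurable⟩ a := by
  obtain ⟨a⟩ := a
  ext γ i j
  change μ.real ((T * a γ * T⁻¹).1 '' (p.1 ⁻¹' {i}) ∩ p.1 ⁻¹' {j}) =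
    μ.real ((a γ).1 '' (T.1 ⁻¹' (p.1 ⁻¹' {i})) ∩ T.1 ⁻¹' (p.1 ⁻¹' {j}))
  have hi := p.2 (measurableSet_singleton i)
  have hj := p.2 (measurableSet_singleton j)
  have hm : MeasurableSet ((a γ).1 '' (T.1 ⁻¹' (p.1 ⁻¹' {i})) ∩ T.1 ⁻¹' (p.1 ⁻¹' {j})) :=
    (MPAut.measurableSet_image (a γ) (T.2.1.measurable hi)).inter (T.2.1.measurable hj)
  rw [measureReal_def, measureReal_def, ← MPAut.measure_image T hm]
  congr 2
  rw [Set.image_inter T.1.injective, Set.image_preimage_eq _ T.1.surjective,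
    ← Equiv.image_symm_eq_preimage, ← Set.image_comp, ← Set.image_comp]
  rfl

variable [IsProbabilityMeasure μ]

lemma stat_mem_pi (Δ : Finset Γ) (k : ℕ) (p : {p : X → Fin (k + 1) // Measurable p})
    (a : ActionSpace Γ μ) :
    stat Δ k p a ∈ Set.Icc (0 : Δ → Fin (k + 1) → Fin (k + 1) → ℝ) 1 := by
  obtain ⟨a⟩ := a
  exact ⟨fun γ i j => measureReal_nonneg, fun γ i j => measureReal_le_one⟩

/-- The nonempty compact set obtained as the closure of the set of all families
`(μ(γ^a(B_i) ∩ B_j))` for `γ` in `Δ` and `i, j ≤ k`, over all measurable partitions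
`B_0, …, B_k` of `X`. -/
noncomputable def statSet (Δ : Finset Γ) (k : ℕ) (a : ActionSpace Γ μ) :
    TopologicalSpace.NonemptyCompacts (Δ → Fin (k + 1) → Fin (k + 1) → ℝ) where
  carrier := closure (Set.range fun p => stat Δ k p a)
  isCompact' := by
    refine isCompact_Icc.of_isClosed_subset isClosed_closure
      (closure_minimal (t := Set.Icc 0 1) ?_ isClosed_Icc)
    rintro _ ⟨p, rfl⟩
    exact stat_mem_pi Δ k p a
  nonempty' := ⟨stat Δ k ⟨fun _ => 0, measurable_const⟩ a, subset_closure ⟨_, rfl⟩⟩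

lemma continuous_stat (Δ : Finset Γ) (k : ℕ) (p : {p : X → Fin (k + 1) // Measurable p}) :
    Continuous (stat Δ k p : ActionSpace Γ μ → _) := by
  refine continuous_pi fun γ => continuous_pi fun i => continuous_pi fun j => ?_
  have hD : MeasurableSet (p.1 ⁻¹' {j}) := p.2 (measurableSet_singleton j)
  have hL : Continuous fun B : MeasuredSets μ => μ.real ((B : Set X) ∩ p.1 ⁻¹' {j}) := by
    let f : MeasuredSets μ → MeasuredSets μ := fun B => ⟨B.1 ∩ p.1 ⁻¹' {j}, B.2.inter hD⟩
    have h1 : Continuous f := by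
      refine (LipschitzWith.of_edist_le fun B C => ?_ : LipschitzWith 1 f).continuous
      change μ ((B.1 ∩ _) ∆ (C.1 ∩ _)) ≤ μ (B.1 ∆ C.1)
      rw [← Set.inter_symmDiff_distrib_right]
      exact measure_mono Set.inter_subset_left
    exact MeasuredSets.lipschitzWith_measureReal.continuous.comp h1
  have hL' := SeparationQuotient.continuous_lift
    (hf := fun B C h => (h.map hL).eq) hL
  convert hL'.comp (continuous_move γ.1 ⟨p.1 ⁻¹' {i}, p.2 (measurableSet_singleton i)⟩) using 1
  ext ⟨a⟩
  rfl

lemma statSet_mono (Δ : Finset Γ) (k : ℕ) {a b : ActionSpace Γ μ} (h : a ≤ b) :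
    (statSet Δ k a : Set (Δ → Fin (k + 1) → Fin (k + 1) → ℝ)) ⊆ statSet Δ k b := by
  refine closure_minimal ?_ isClosed_closure
  rintro _ ⟨p, rfl⟩
  refine map_mem_closure (continuous_stat Δ k p) h ?_
  rintro _ ⟨T, rfl⟩
  exact ⟨_, (stat_smul Δ k p T b).symm⟩

end ActionSpace

variable (Γ μ)

/-- The space of weak equivalence classes of measure-preserving actions of `Γ` on `(X, μ)`, with
the partial order induced by weak containment. Two actions are weakly equivalent iff each weakly
contains the other, i.e., iff their conjugacy orbits have the same closure. -/
abbrev WeakClasses : Type _ := Antisymmetrization (ActionSpace Γ μ) (· ≤ ·)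

/-- The quotient topology on the space of weak equivalence classes. -/
@[reducible] noncomputable def quotientTopology : TopologicalSpace (WeakClasses Γ μ) :=
  TopologicalSpace.coinduced (toAntisymmetrization (α := ActionSpace Γ μ) (· ≤ ·)) inferInstance

variable [IsProbabilityMeasure μ]

variable {Γ μ} in
/-- The compact set `statSet Δ k a` depends only on the weak equivalence class of `a`. -/
noncomputable def WeakClasses.statSet (Δ : Finset Γ) (k : ℕ) : WeakClasses Γ μ →
    TopologicalSpace.NonemptyCompacts (Δ → Fin (k + 1) → Fin (k + 1) → ℝ) :=
  Quotient.lift (ActionSpace.statSet Δ k) fun _ _ h =>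
    SetLike.coe_injective
      ((ActionSpace.statSet_mono Δ k h.1).antisymm (ActionSpace.statSet_mono Δ k h.2))

/-- The Abért–Elek topology on the space of weak equivalence classes: the coarsest topology for
which the compact sets `statSet Δ k a` depend continuously, in the Hausdorff metric, on the class
of `a`, for all finite `Δ ⊆ Γ` and all `k`. -/
@[reducible] noncomputable def abertElekTopology : TopologicalSpace (WeakClasses Γ μ) :=
  ⨅ (Δ : Finset Γ) (k : ℕ), TopologicalSpace.induced (WeakClasses.statSet Δ k) inferInstance

end Actions

end WeakEquivalence

/-! The heart of the matter is that weak containment is inclusion of statistics: `a ≤ b` iff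
`statSet Δ k a ⊆ statSet Δ k b` for all `Δ`, `k` (`ActionSpace.le_iff_forall_statSet_subset`). One
direction holds because statistics are continuous and conjugating an action only changes the
partition. For the other, suppose `q` has under `b` nearly the statistics that `p` has under `a`.
Since `μ` is nonatomic, some automorphism `T` carries the pieces of `q` nearly onto those of `p`,
and then `T • b` is close to `a` (`ActionSpace.exists_smul_mem_of_stat`).

Hence the statistics embed the classes, with `τ`, in a countable product of hyperspaces, where
inclusion is closed. The image is compact (`exists_tendsto_statSet`): along an ultrafilter of
actions, choose countably many partitions whose statistics approximate a dense set of limit points,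
encode them by itineraries in a shift space, and take the weak limit of the laws. The limit is an
invariant atomless measure whose statistics are exactly the limit sets, so its shift action can be
transported to `(X, μ)`.

Thus `(τ, ≼)` is a compact ordered space, and its upper topology is `σ`
(`WeakClasses.upperTopology_abertElek`). Stable compactness, the patch topology and the
specialization order are then read off from Nachbin separation, valid in every compact ordered
space. -/

namespace WeakEquivalence

/-! ### Compact ordered spaces and their upper topologies -/

section CompactOrderedSpace

variable {Y : Type*} [τ : TopologicalSpace Y] [PartialOrder Y]

lemma le_upperTopology : τ ≤ upperTopology τ := fun _ h => h.1

lemma isCompact_upperTopology {K : Set Y} (hK : IsCompact K) :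
    @IsCompact Y (upperTopology τ) K := by
  have h := @IsCompact.image _ _ τ (upperTopology τ) _ _ hK
    (@continuous_id_of_le _ τ (upperTopology τ) le_upperTopology)
  rwa [image_id] at h

variable [OrderClosedTopology Y]

lemma specLE_upperTopology {x y : Y} : SpecLE (upperTopology τ) x y ↔ x ≤ y := by
  rw [SpecLE, @mem_closure_iff _ (upperTopology τ)]
  constructor
  · intro h
    by_contra hxy
    obtain ⟨z, hz, rfl⟩ := h (Iic y)ᶜ ⟨isClosed_Iic.isOpen_compl, (isLowerSet_Iic y).compl⟩ hxy
    exact hz self_mem_Iic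
  · intro h U hU hx
    exact ⟨y, hU.2 h hx, rfl⟩

variable [CompactSpace Y]

/-- A projection of a compact piece of the closed graph of the order. -/
lemma isClosed_upperClosure_of_isClosed {C : Set Y} (hC : IsClosed C) :
    IsClosed (upperClosure C : Set Y) := by
  have h : (upperClosure C : Set Y) = Prod.snd '' ((C ×ˢ univ) ∩ {p : Y × Y | p.1 ≤ p.2}) := by
    ext y
    simp [mem_upperClosure]
  rw [h]
  exact (((hC.prod isClosed_univ).inter
    OrderClosedTopology.isClosed_le').isCompact.image continuous_snd).isClosed

lemma isClosed_lowerClosure_of_isClosed {C : Set Y} (hC : IsClosed C) :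
    IsClosed (lowerClosure C : Set Y) := by
  have h : (lowerClosure C : Set Y) = Prod.fst '' ((univ ×ˢ C) ∩ {p : Y × Y | p.1 ≤ p.2}) := by
    ext y
    simp [mem_lowerClosure, and_comm]
  rw [h]
  exact (((isClosed_univ.prod hC).inter
    OrderClosedTopology.isClosed_le').isCompact.image continuous_fst).isClosed

/-- Nachbin's separation theorem for compact ordered spaces. -/
lemma exists_disjoint_isOpen_isUpperSet_isLowerSet {A B : Set Y} (hA : IsClosed A)
    (hA' : IsUpperSet A) (hB : IsClosed B) (hB' : IsLowerSet B) (hAB : Disjoint A B) :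
    ∃ V W : Set Y, IsOpen V ∧ IsUpperSet V ∧ A ⊆ V ∧ IsOpen W ∧ IsLowerSet W ∧ B ⊆ W ∧
      Disjoint V W := by
  obtain ⟨U, U', hU, hU', hAU, hBU, hd⟩ := normal_separation hA hB hAB
  refine ⟨(lowerClosure Uᶜ : Set Y)ᶜ, (upperClosure U'ᶜ : Set Y)ᶜ,
    (isClosed_lowerClosure_of_isClosed hU.isClosed_compl).isOpen_compl,
    (lowerClosure Uᶜ).lower.compl, ?_,
    (isClosed_upperClosure_of_isClosed hU'.isClosed_compl).isOpen_compl,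
    (upperClosure U'ᶜ).upper.compl, ?_, ?_⟩
  · rintro x hx ⟨y, hy, hxy⟩
    exact hy (hAU (hA' hxy hx))
  · rintro x hx ⟨y, hy, hxy⟩
    exact hy (hBU (hB' hxy hx))
  · refine hd.mono ?_ ?_
    · exact compl_subset_comm.1 subset_lowerClosure
    · exact compl_subset_comm.1 subset_upperClosure

lemma exists_disjoint_isOpen_of_not_le {x y : Y} (h : ¬x ≤ y) :
    ∃ V W : Set Y, IsOpen V ∧ IsUpperSet V ∧ x ∈ V ∧ IsOpen W ∧ IsLowerSet W ∧ y ∈ W ∧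
      Disjoint V W := by
  obtain ⟨V, W, hV, hV', hxV, hW, hW', hyW, hd⟩ :=
    exists_disjoint_isOpen_isUpperSet_isLowerSet (isClosed_Ici (a := x)) (isUpperSet_Ici x)
      (isClosed_Iic (a := y)) (isLowerSet_Iic y)
      (disjoint_left.2 fun z hz hz' => h (le_trans hz hz'))
  exact ⟨V, W, hV, hV', hxV self_mem_Ici, hW, hW', hyW self_mem_Iic, hd⟩

/-- Nachbin separation of a point outside `K` from each point of `K` uses upper open sets on the
side of `K`, so compactness in the coarser topology suffices to extract a finite subcover. -/
lemma isClosed_of_isCompact_upperTopology {K : Set Y} (hK : @IsCompact Y (upperTopology τ) K)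
    (hK' : IsUpperSet K) : IsClosed K := by
  rw [← isOpen_compl_iff, isOpen_iff_mem_nhds]
  intro x hx
  have hq : ∀ q : K, ¬q.1 ≤ x := fun q hqx => hx (hK' hqx q.2)
  choose V W hV hV' hxV hW _ hyW hd using fun q : K => exists_disjoint_isOpen_of_not_le (hq q)
  obtain ⟨t, ht⟩ := @IsCompact.elim_finite_subcover Y (upperTopology τ) _ _ hK V
    (fun q => ⟨hV q, hV' q⟩) (fun q hq => mem_iUnion.2 ⟨⟨q, hq⟩, hxV _⟩)
  filter_upwards [(Filter.biInter_finset_mem t).2 fun q _ => (hW q).mem_nhds (hyW q)] with y hy hyK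
  obtain ⟨q, hqt, hyq⟩ := mem_iUnion₂.1 (ht hyK)
  exact disjoint_left.1 (hd q) hyq (mem_iInter₂.1 hy q hqt)

/-- Complements of open lower sets serve as compact neighborhoods, and the greatest limit of an
ultrafilter is its `τ`-limit. -/
theorem isStablyCompact_upperTopology : IsStablyCompact (upperTopology τ) where
  locallyCompact := by
    refine @LocallyCompactSpace.mk Y (upperTopology τ) fun x N hN => ?_
    obtain ⟨U, hUN, hU, hxU⟩ := (@mem_nhds_iff Y (upperTopology τ) x N).1 hN
    obtain ⟨V, W, hV, hV', hxV, hW, hW', hUW, hd⟩ :=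
      exists_disjoint_isOpen_isUpperSet_isLowerSet (isClosed_Ici (a := x)) (isUpperSet_Ici x)
        hU.1.isClosed_compl hU.2.compl
        (disjoint_left.2 fun z (hz : x ≤ z) (hz' : z ∉ U) => hz' (hU.2 hz hxU))
    refine ⟨Wᶜ, ?_, (compl_subset_comm.1 hUW).trans hUN,
      isCompact_upperTopology hW.isClosed_compl.isCompact⟩
    exact (@mem_nhds_iff Y (upperTopology τ) x Wᶜ).2
      ⟨V, hd.subset_compl_right, ⟨hV, hV'⟩, hxV self_mem_Ici⟩
  stronglySober F := by
    obtain ⟨x, -, hx⟩ := isCompact_univ.ultrafilter_le_nhds F (by simp)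
    have hg : IsGreatestLimit (upperTopology τ) F x := by
      refine ⟨hx.trans (nhds_mono le_upperTopology), fun y hy => specLE_upperTopology.2 ?_⟩
      by_contra hyx
      obtain ⟨V, W, hV, hV', hxV, hW, hW', hyW, hd⟩ := exists_disjoint_isOpen_of_not_le hyx
      have h1 : V ∈ F := hy (@IsOpen.mem_nhds Y (upperTopology τ) y V ⟨hV, hV'⟩ hxV)
      have h2 : W ∈ F := hx (hW.mem_nhds hyW)
      exact F.empty_notMem (by simpa [hd.inter_eq] using Filter.inter_mem h1 h2)
    exact ⟨x, hg, fun y hy => le_antisymm (specLE_upperTopology.1 (hg.2 y hy.1))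
      (specLE_upperTopology.1 (hy.2 x hg.1))⟩

/-- The patch topology is coarser than `τ` and, by Nachbin separation, Hausdorff; a compact topology
has no strictly coarser Hausdorff topology. -/
theorem patchTopology_upperTopology : patchTopology (upperTopology τ) = τ := by
  have hle : τ ≤ patchTopology (upperTopology τ) := by
    refine le_generateFrom fun U hU => ?_
    rw [← isClosed_compl_iff]
    rcases hU with h | ⟨h, h'⟩
    · exact h.mono le_upperTopology
    · exact isClosed_of_isCompact_upperTopology h
        fun x y hxy hx => h' x hx y (specLE_upperTopology.2 hxy)
  have hV : ∀ V : Set Y, IsOpen V → IsUpperSet V → IsOpen[patchTopology (upperTopology τ)] V := by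
    intro V hV hV'
    refine TopologicalSpace.isOpen_generateFrom_of_mem (Or.inl ?_)
    rw [@isClosed_compl_iff _ (upperTopology τ)]
    exact ⟨hV, hV'⟩
  have hW : ∀ W : Set Y, IsOpen W → IsLowerSet W → IsOpen[patchTopology (upperTopology τ)] W := by
    intro W hW hW'
    exact TopologicalSpace.isOpen_generateFrom_of_mem (Or.inr
      ⟨isCompact_upperTopology hW.isClosed_compl.isCompact,
        fun x hx y hxy => hW'.compl (specLE_upperTopology.1 hxy) hx⟩)
  have hT2 : @T2Space Y (patchTopology (upperTopology τ)) := by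
    refine @T2Space.mk Y (patchTopology (upperTopology τ)) fun x y hxy => ?_
    by_cases h : x ≤ y
    · obtain ⟨V, W, h1, h2, h3, h4, h5, h6, hd⟩ :=
        exists_disjoint_isOpen_of_not_le fun h' => hxy (le_antisymm h h')
      exact ⟨W, V, hW W h4 h5, hV V h1 h2, h6, h3, hd.symm⟩
    · obtain ⟨V, W, h1, h2, h3, h4, h5, h6, hd⟩ := exists_disjoint_isOpen_of_not_le h
      exact ⟨V, W, hV V h1 h2, hW W h4 h5, h3, h6, hd⟩
  refine le_antisymm (fun U hU => ?_) hle
  have hc := @IsCompact.image _ _ τ (patchTopology (upperTopology τ)) _ _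
    hU.isClosed_compl.isCompact (@continuous_id_of_le _ τ (patchTopology (upperTopology τ)) hle)
  rw [image_id] at hc
  exact (@isClosed_compl_iff _ (patchTopology (upperTopology τ)) U).1
    (@IsCompact.isClosed _ (patchTopology (upperTopology τ)) hT2 _ hc)

end CompactOrderedSpace

/-! ### Distribution functions of atomless measures -/

section CDF

open ProbabilityTheory

variable (m : Measure ℝ) [IsProbabilityMeasure m] [NullSingletonClass m]

lemma continuous_cdf : Continuous (cdf m) := by
  rw [continuous_iff_continuousAt]
  intro x
  rw [(monotone_cdf m).continuousAt_iff_leftLim_eq_rightLim, StieltjesFunction.rightLim_eq]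
  have h := (cdf m).measure_singleton x
  rw [measure_cdf, measure_singleton, eq_comm, ENNReal.ofReal_eq_zero] at h
  exact le_antisymm ((monotone_cdf m).leftLim_le le_rfl) (sub_nonpos.1 h)

lemma Ioo_subset_range_cdf : Ioo 0 1 ⊆ range (cdf m) := by
  intro t ht
  obtain ⟨a, ha⟩ := ((tendsto_cdf_atBot m).eventually (gt_mem_nhds ht.1)).exists
  obtain ⟨b, hb⟩ := ((tendsto_cdf_atTop m).eventually (lt_mem_nhds ht.2)).exists
  exact mem_range_of_exists_le_of_exists_ge (continuous_cdf m) ⟨a, ha.le⟩ ⟨b, hb.le⟩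

/-- The probability integral transform of an atomless probability measure. -/
lemma map_cdf : m.map (cdf m) = volume.restrict (Ioo 0 1) := by
  have hm : Measurable (cdf m) := (continuous_cdf m).measurable
  have : IsProbabilityMeasure (m.map (cdf m)) := Measure.isProbabilityMeasure_map hm.aemeasurable
  have : IsProbabilityMeasure (volume.restrict (Ioo (0 : ℝ) 1)) := ⟨by simp⟩
  -- Both measures of `Iic t` obey the same comparisons with every `s` in `(0, 1)`, which pin the
  -- value down. Writing `s` as a value of the distribution function avoids computing its preimages
  -- exactly.
  have key : ∀ t s : ℝ, s ∈ Ioo 0 1 →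
      (t < s → (m.map (cdf m)).real (Iic t) ≤ s) ∧ (s ≤ t → s ≤ (m.map (cdf m)).real (Iic t)) := by
    intro t s hs
    obtain ⟨u, rfl⟩ := Ioo_subset_range_cdf m hs
    rw [map_measureReal_apply hm measurableSet_Iic]
    constructor
    · intro h
      rw [cdf_eq_real]
      refine measureReal_mono fun x hx => ?_
      exact ((monotone_cdf m).reflect_lt (lt_of_le_of_lt hx h)).le
    · intro h
      nth_rw 1 [cdf_eq_real]
      exact measureReal_mono fun x hx => (monotone_cdf m hx).trans h
  have key' : ∀ t s : ℝ, s ∈ Ioo 0 1 →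
      (t < s → (volume.restrict (Ioo (0 : ℝ) 1)).real (Iic t) ≤ s) ∧
        (s ≤ t → s ≤ (volume.restrict (Ioo (0 : ℝ) 1)).real (Iic t)) := by
    intro t s hs
    rw [measureReal_restrict_apply measurableSet_Iic]
    have hv : volume.real (Ioo 0 s) = s := by rw [Real.volume_real_Ioo_of_le hs.1.le, sub_zero]
    constructor
    · intro h
      refine le_of_le_of_eq (measureReal_mono ?_ (by simp)) hv
      exact fun x hx => ⟨hx.2.1, lt_of_le_of_lt hx.1 h⟩
    · intro h
      refine le_of_eq_of_le hv.symm (measureReal_mono ?_ ?_)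
      · exact fun x hx => ⟨hx.2.le.trans h, hx.1, hx.2.trans hs.2⟩
      · exact measure_ne_top_of_subset inter_subset_right (by simp)
  have aux : ∀ (ν ν' : Measure ℝ) [IsProbabilityMeasure ν] [IsProbabilityMeasure ν'] (t : ℝ),
      (∀ s ∈ Ioo (0 : ℝ) 1, t < s → ν.real (Iic t) ≤ s) →
      (∀ s ∈ Ioo (0 : ℝ) 1, s ≤ t → s ≤ ν'.real (Iic t)) → ν.real (Iic t) ≤ ν'.real (Iic t) := by
    intro ν ν' _ _ t h h'
    by_contra! hlt
    obtain ⟨s, hs, hs'⟩ := exists_between hlt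
    have h01 : s ∈ Ioo (0 : ℝ) 1 :=
      ⟨lt_of_le_of_lt measureReal_nonneg hs, lt_of_lt_of_le hs' measureReal_le_one⟩
    rcases lt_or_ge t s with hts | hts
    · exact absurd (h s h01 hts) (not_le.2 hs')
    · exact absurd (h' s h01 hts) (not_le.2 hs)
  refine Measure.ext_of_Iic _ _ fun t => (measureReal_eq_measureReal_iff).1 (le_antisymm ?_ ?_)
  · exact aux _ _ t (fun s hs => (key t s hs).1) fun s hs => (key' t s hs).2
  · exact aux _ _ t (fun s hs => (key' t s hs).1) fun s hs => (key t s hs).2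

/-- The distribution function of an atomless probability measure is injective on a conull set. -/
lemma exists_injOn_cdf : ∃ S : Set ℝ, MeasurableSet S ∧ m Sᶜ = 0 ∧ InjOn (cdf m) S := by
  have hm : Measurable (cdf m) := (continuous_cdf m).measurable
  -- Two points with equal values bound a flat stretch containing a rational `r`, so both lie in the
  -- level set of `r`; level sets are null because the image measure is uniform.
  refine ⟨(⋃ r : ℚ, cdf m ⁻¹' {cdf m r})ᶜ,
    (MeasurableSet.iUnion fun r => hm (measurableSet_singleton _)).compl, ?_, ?_⟩
  · rw [compl_compl, measure_iUnion_null_iff]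
    intro r
    rw [← Measure.map_apply hm (measurableSet_singleton _), map_cdf]
    simp
  · have key : ∀ x y : ℝ, x < y → cdf m x = cdf m y → x ∈ ⋃ r : ℚ, cdf m ⁻¹' {cdf m r} := by
      intro x y hxy h
      obtain ⟨r, hxr, hry⟩ := exists_rat_btwn hxy
      exact mem_iUnion.2 ⟨r, le_antisymm (monotone_cdf m hxr.le)
        (h ▸ monotone_cdf m hry.le)⟩
    intro x hx y hy h
    rcases lt_trichotomy x y with hxy | hxy | hxy
    · exact absurd (key x y hxy h) hx
    · exact hxy
    · exact absurd (key y x hxy h.symm) hy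

end CDF

/-! ### Isomorphisms of atomless standard probability spaces -/

section Isomorphism

/-- Liouville numbers are residual, whereas countable sets of reals are meagre. Being also Lebesgue
null, they supply uncountable null sets. -/
lemma not_countable_liouville_inter_Ioo : ¬({x : ℝ | Liouville x} ∩ Ioo 0 1).Countable := by
  intro h
  have h1 : ∀ᶠ x in residual ℝ, x ∉ {x : ℝ | Liouville x} ∩ Ioo 0 1 := by
    have : IsMeagre ({x : ℝ | Liouville x} ∩ Ioo 0 1) := by
      rw [← biUnion_of_singleton ({x : ℝ | Liouville x} ∩ Ioo 0 1)]
      refine isMeagre_biUnion h fun x _ => ?_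
      exact (isClosed_singleton.isNowhereDense_iff.2 (interior_singleton x)).isMeagre
    exact this
  have h2 := dense_of_mem_residual (h1.and eventually_residual_liouville)
  obtain ⟨x, hx, hx'⟩ := h2.exists_mem_open isOpen_Ioo (nonempty_Ioo.2 (zero_lt_one (α := ℝ)))
  exact hx.1 ⟨hx.2, hx'⟩

variable {X : Type*} [MeasurableSpace X]

lemma not_countable_of_nullSingletonClass (μ : Measure X) [IsProbabilityMeasure μ]
    [NullSingletonClass μ] : ¬Countable X := by
  intro h
  have := (countable_univ (α := X)).measure_zero μ
  simp at this

lemma nullSingletonClass_map {Y : Type*} [MeasurableSpace Y] [MeasurableSingletonClass Y]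
    {μ : Measure X} [NullSingletonClass μ] {f : X → Y} (hf : Measurable f)
    (hf' : Function.Injective f) : NullSingletonClass (μ.map f) where
  measure_singleton y := by
    rw [Measure.map_apply hf (measurableSet_singleton y)]
    exact (subsingleton_singleton.preimage hf').measure_zero μ

variable [StandardBorelSpace X]

/-- An atomless standard probability space has uncountable null sets. -/
lemma exists_null_not_countable (μ : Measure X) [IsProbabilityMeasure μ] [NullSingletonClass μ] :
    ∃ P : Set X, MeasurableSet P ∧ μ P = 0 ∧ ¬P.Countable := by
  let φ : X ≃ᵐ ℝ := PolishSpace.measurableEquivOfNotCountable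
    (not_countable_of_nullSingletonClass μ) (not_countable_iff.2 inferInstance)
  have := nullSingletonClass_map (μ := μ) φ.measurable φ.injective
  have : IsProbabilityMeasure (μ.map φ) := Measure.isProbabilityMeasure_map φ.measurable.aemeasurable
  set F := ProbabilityTheory.cdf (μ.map φ)
  have hF : Measurable F := (continuous_cdf (μ.map φ)).measurable
  have hL : MeasurableSet ({x : ℝ | Liouville x} ∩ Ioo 0 1) :=
    IsGδ.setOfPred_liouville.measurableSet.inter measurableSet_Ioo
  refine ⟨φ ⁻¹' (F ⁻¹' ({x : ℝ | Liouville x} ∩ Ioo 0 1)), φ.measurable (hF hL), ?_, fun h => ?_⟩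
  · rw [← Measure.map_apply φ.measurable (hF hL), ← Measure.map_apply hF hL, map_cdf]
    exact measure_mono_null inter_subset_left
      (Measure.absolutelyContinuous_of_le Measure.restrict_le_self volume_setOfPred_liouville)
  · refine not_countable_liouville_inter_Ioo ((h.image (F ∘ φ)).mono ?_)
    intro t ht
    obtain ⟨u, hu⟩ := Ioo_subset_range_cdf (μ.map φ) ht.2
    refine ⟨φ.symm u, ?_, ?_⟩
    · simpa [F, hu] using! ht
    · simpa using hu

/-- A measure-preserving map between atomless standard probability spaces that is injective on a
conull set agrees almost everywhere with an isomorphism. -/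
lemma exists_measurableEquiv_ae_eq {Y : Type*} [MeasurableSpace Y] [StandardBorelSpace Y]
    {μ : Measure X} {ν : Measure Y} [IsProbabilityMeasure μ] [NullSingletonClass μ]
    [IsProbabilityMeasure ν] [NullSingletonClass ν] {f : X → Y} (hf : MeasurePreserving f μ ν)
    {S : Set X} (hS : MeasurableSet S) (hS' : μ Sᶜ = 0) (hfS : InjOn f S) :
    ∃ e : X ≃ᵐ Y, ∀ᵐ x ∂μ, e x = f x := by
  classical
  obtain ⟨P, hP, hP0, hPc⟩ := exists_null_not_countable μ
  obtain ⟨Q, hQ, hQ0, hQc⟩ := exists_null_not_countable ν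
  -- Discarding `P` and `f ⁻¹' Q` leaves uncountable complements on both sides, which are therefore
  -- Borel isomorphic; this makes the isomorphism defined everywhere.
  set S₁ := S \ (P ∪ f ⁻¹' Q) with hS₁
  have hmS₁ : MeasurableSet S₁ := hS.diff (hP.union (hf.measurable hQ))
  have hmT₁ : MeasurableSet (range (S₁.domRestrict f)) := by
    rw [range_domRestrict]
    exact hmS₁.image_of_measurable_injOn hf.measurable (hfS.mono sdiff_subset)
  have := hmS₁.standardBorel
  have := hmS₁.compl.standardBorel
  have := hmT₁.compl.standardBorel
  have hemb : MeasurableEmbedding (S₁.domRestrict f) :=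
    (hf.measurable.comp measurable_subtype_coe).measurableEmbedding
      (injOn_iff_injective.1 (hfS.mono sdiff_subset))
  let e₁ : S₁ ≃ᵐ range (S₁.domRestrict f) := hemb.equivRange
  have he₁ : ∀ x : S₁, (e₁ x : Y) = f x := fun x =>
    congrArg Subtype.val (hemb.equivRange_apply x)
  have hcX : ¬Countable (S₁ᶜ : Set X) := fun h =>
    hPc ((countable_coe_iff.1 h).mono fun x hx (hx' : x ∈ S₁) => hx'.2 (Or.inl hx))
  have hcY : ¬Countable ((range (S₁.domRestrict f))ᶜ : Set Y) := fun h =>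
    hQc ((countable_coe_iff.1 h).mono (by rintro _ hy ⟨x, rfl⟩; exact x.2.2 (Or.inr hy)))
  let e₂ : (S₁ᶜ : Set X) ≃ᵐ ((range (S₁.domRestrict f))ᶜ : Set Y) :=
    PolishSpace.measurableEquivOfNotCountable hcX hcY
  refine ⟨(MeasurableEquiv.sumCompl hmS₁).symm.trans
    ((MeasurableEquiv.sumCongr e₁ e₂).trans (MeasurableEquiv.sumCompl hmT₁)), ?_⟩
  have hnull : μ S₁ᶜ = 0 := by
    refine measure_mono_null (t := Sᶜ ∪ (P ∪ f ⁻¹' Q)) ?_ ?_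
    · intro x hx
      by_contra h
      rw [mem_union, not_or, notMem_compl_iff] at h
      exact hx h
    · rw [measure_union_null_iff, measure_union_null_iff, hf.measure_preimage hQ.nullMeasurableSet]
      exact ⟨hS', hP0, hQ0⟩
  have hae : ∀ᵐ x ∂μ, x ∈ S₁ := hnull
  filter_upwards [hae] with x hx
  have h1 : (MeasurableEquiv.sumCompl hmS₁).symm x = Sum.inl ⟨x, hx⟩ :=
    Equiv.sumCompl_symm_apply_of_pos hx
  change MeasurableEquiv.sumCompl hmT₁ (MeasurableEquiv.sumCongr e₁ e₂
    ((MeasurableEquiv.sumCompl hmS₁).symm x)) = f x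
  rw [h1]
  exact he₁ ⟨x, hx⟩

/-- Every finite measurable partition of an atomless standard probability space is carried to a
partition of the unit interval into consecutive intervals by some isomorphism. -/
lemma exists_measurableEquiv_real (μ : Measure X) [IsProbabilityMeasure μ] [NullSingletonClass μ]
    {k : ℕ} {q : X → Fin (k + 1)} (hq : Measurable q) :
    ∃ e : X ≃ᵐ ℝ, MeasurePreserving e μ (volume.restrict (Ioo 0 1)) ∧
      ∀ᵐ x ∂μ, e x ∈ Icc (μ.real {y | q y < q x}) (μ.real {y | q y ≤ q x}) := by
  let φ : X ≃ᵐ ℝ := PolishSpace.measurableEquivOfNotCountable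
    (not_countable_of_nullSingletonClass μ) (not_countable_iff.2 inferInstance)
  -- An injection placing the piece `q = i` inside the interval `(i, i + 1)`; the distribution
  -- function of its law then lines the pieces up in `(0, 1)`.
  let ψ : X → ℝ := fun x => ((q x : ℕ) : ℝ) + Real.sigmoid (φ x)
  have hψm : Measurable ψ :=
    ((measurable_from_top (f := fun i : Fin (k + 1) => ((i : ℕ) : ℝ))).comp hq).add
      (_root_.continuous_sigmoid.measurable.comp φ.measurable)
  have hψ₀ : ∀ x, ((q x : ℕ) : ℝ) < ψ x := fun x => lt_add_of_pos_right _ (Real.sigmoid_pos _)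
  have hψ₁ : ∀ x, ψ x < (q x : ℕ) + 1 := fun x => by
    simpa [ψ] using Real.sigmoid_lt_one (φ x)
  have hψq : ∀ x (n : ℕ), ψ x ≤ n ↔ (q x : ℕ) < n := by
    intro x n
    constructor
    · intro h
      exact_mod_cast (hψ₀ x).trans_le h
    · intro h
      have : ((q x : ℕ) : ℝ) + 1 ≤ n := by exact_mod_cast h
      exact (hψ₁ x).le.trans this
  have hψi : Function.Injective ψ := by
    intro x y h
    have hxy : q x = q y := by
      refine le_antisymm ?_ ?_
      · have := (hψq x (q y + 1)).1 (h ▸ by push_cast; exact (hψ₁ y).le)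
        exact Nat.lt_succ_iff.1 this
      · have := (hψq y (q x + 1)).1 (h ▸ by push_cast; exact (hψ₁ x).le)
        exact Nat.lt_succ_iff.1 this
    simp only [ψ, hxy, add_right_inj] at h
    exact φ.injective (Real.sigmoid_injective h)
  have := nullSingletonClass_map (μ := μ) hψm hψi
  have : IsProbabilityMeasure (μ.map ψ) := Measure.isProbabilityMeasure_map hψm.aemeasurable
  have : IsProbabilityMeasure (volume.restrict (Ioo (0 : ℝ) 1)) := ⟨by simp⟩
  set F := ProbabilityTheory.cdf (μ.map ψ) with hFdef
  have hF : Measurable F := (continuous_cdf (μ.map ψ)).measurable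
  have hFn : ∀ n : ℕ, F n = μ.real {y | (q y : ℕ) < n} := by
    intro n
    rw [hFdef, ProbabilityTheory.cdf_eq_real, map_measureReal_apply hψm measurableSet_Iic]
    congr 1
    ext y
    exact hψq y n
  obtain ⟨S, hS, hS0, hSi⟩ := exists_injOn_cdf (μ.map ψ)
  have hmp : MeasurePreserving (F ∘ ψ) μ (volume.restrict (Ioo 0 1)) := by
    refine ⟨hF.comp hψm, ?_⟩
    rw [← Measure.map_map hF hψm, map_cdf]
  obtain ⟨e, he⟩ := exists_measurableEquiv_ae_eq hmp (S := ψ ⁻¹' S) (hψm hS)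
    (by rwa [← preimage_compl, ← Measure.map_apply hψm hS.compl])
    (fun x hx y hy h => hψi (hSi hx hy h))
  refine ⟨e, ⟨e.measurable, ?_⟩, ?_⟩
  · rw [Measure.map_congr he, hmp.map_eq]
  · filter_upwards [he] with x hx
    rw [hx]
    constructor
    · refine le_of_eq_of_le (hFn (q x)).symm ?_
      exact ProbabilityTheory.monotone_cdf _ (hψ₀ x).le
    · refine (ProbabilityTheory.monotone_cdf _ (hψ₁ x).le).trans (le_of_eq ?_)
      have := hFn (q x + 1)
      push_cast at this
      rw [this]
      congr 1
      ext y
      exact Nat.lt_succ_iff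

/-- Two measurable partitions whose pieces have nearly the same measures can be nearly matched by
an automorphism. -/
lemma exists_mpAut_measureReal_symmDiff_le (μ : Measure X) [IsProbabilityMeasure μ]
    [NullSingletonClass μ] {k : ℕ} {p q : X → Fin (k + 1)} (hp : Measurable p)
    (hq : Measurable q) :
    ∃ T : MPAut μ, ∀ i, μ.real ({x | p (T.1 x) = i} ∆ {x | q x = i}) ≤
      |μ.real {x | q x < i} - μ.real {x | p x < i}| +
        |μ.real {x | q x ≤ i} - μ.real {x | p x ≤ i}| := by
  obtain ⟨f, hf, hf'⟩ := exists_measurableEquiv_real μ hp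
  obtain ⟨e, he, he'⟩ := exists_measurableEquiv_real μ hq
  have hT : MeasurePreserving (e.trans f.symm) μ μ := (hf.symm f).comp he
  refine ⟨⟨(e.trans f.symm).toEquiv, hT, hT.symm _⟩, fun i => ?_⟩
  have hae : ∀ᵐ x ∂μ, e x ∈ Icc (μ.real {y | p y < p ((e.trans f.symm) x)})
      (μ.real {y | p y ≤ p ((e.trans f.symm) x)}) := by
    filter_upwards [hT.quasiMeasurePreserving.ae hf'] with x hx
    simpa using! hx
  have hsub : ({x | p ((e.trans f.symm) x) = i} ∆ {x | q x = i} : Set X) ≤ᵐ[μ]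
      e ⁻¹' (uIcc (μ.real {x | p x < i}) (μ.real {x | q x < i}) ∪
        uIcc (μ.real {x | p x ≤ i}) (μ.real {x | q x ≤ i})) := by
    -- A point in the `i`-th interval of one partition but in the `j`-th of the other lies between
    -- the two left endpoints of index `i` if `j < i`, and between the two right endpoints if `j >
    -- i`.
    have hcase : ∀ (p q : X → Fin (k + 1)) (j : Fin (k + 1)) (y : ℝ), j ≠ i →
        y ∈ Icc (μ.real {x | p x < i}) (μ.real {x | p x ≤ i}) →
        y ∈ Icc (μ.real {x | q x < j}) (μ.real {x | q x ≤ j}) →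
        y ∈ uIcc (μ.real {x | p x < i}) (μ.real {x | q x < i}) ∪
          uIcc (μ.real {x | p x ≤ i}) (μ.real {x | q x ≤ i}) := by
      intro p q j y hji hy hy'
      rcases hji.lt_or_gt with h | h
      · exact Or.inl (mem_uIcc.2 (Or.inl ⟨hy.1, hy'.2.trans
          (measureReal_mono fun x (hx : q x ≤ j) => hx.trans_lt h)⟩))
      · exact Or.inr (mem_uIcc.2 (Or.inr ⟨(measureReal_mono
          fun x (hx : q x ≤ i) => hx.trans_lt h).trans hy'.1, hy.2⟩))
    filter_upwards [he', hae] with x hx hx' hxs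
    rcases hxs with ⟨h1, h2⟩ | ⟨h1, h2⟩
    · rw [show p ((e.trans f.symm) x) = i from h1] at hx'
      exact hcase p q (q x) (e x) h2 hx' hx
    · rw [show q x = i from h1] at hx
      have := hcase q p (p ((e.trans f.symm) x)) (e x) h2 hx hx'
      rwa [uIcc_comm, uIcc_comm (μ.real {x | q x ≤ i})] at this
  have hfin : ∀ a b c d : ℝ, volume (uIcc a b ∪ uIcc c d) ≠ ⊤ := fun a b c d =>
    ((isCompact_uIcc.union isCompact_uIcc).measure_lt_top).ne
  calc μ.real ({x | p ((e.trans f.symm) x) = i} ∆ {x | q x = i})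
      ≤ μ.real (e ⁻¹' (uIcc (μ.real {x | p x < i}) (μ.real {x | q x < i}) ∪
        uIcc (μ.real {x | p x ≤ i}) (μ.real {x | q x ≤ i}))) :=
        ENNReal.toReal_mono (measure_ne_top _ _) (measure_mono_ae hsub)
    _ = (volume.restrict (Ioo 0 1)).real (uIcc (μ.real {x | p x < i}) (μ.real {x | q x < i}) ∪
        uIcc (μ.real {x | p x ≤ i}) (μ.real {x | q x ≤ i})) := by
        exact congrArg ENNReal.toReal (he.measure_preimage
          (IsCompact.union isCompact_uIcc isCompact_uIcc).measurableSet.nullMeasurableSet)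
    _ ≤ volume.real (uIcc (μ.real {x | p x < i}) (μ.real {x | q x < i}) ∪
        uIcc (μ.real {x | p x ≤ i}) (μ.real {x | q x ≤ i})) :=
        ENNReal.toReal_mono (hfin _ _ _ _) (Measure.restrict_apply_le _ _)
    _ ≤ _ := by
        refine (measureReal_union_le _ _).trans (le_of_eq ?_)
        simp [measureReal_def, Real.volume_interval]

end Isomorphism

/-! ### Statistics of partitions determine weak containment -/

section Statistics

variable {X : Type*} [MeasurableSpace X] {μ : Measure X} [IsProbabilityMeasure μ]

lemma measureReal_image_inter_preimage (T : MPAut μ) {ι : Type*} [Finite ι] [MeasurableSpace ι]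
    [MeasurableSingletonClass ι] {p : X → ι} (hp : Measurable p) (I J : Finset ι) :
    μ.real (T.1 '' (p ⁻¹' I) ∩ p ⁻¹' J) =
      ∑ i ∈ I, ∑ j ∈ J, μ.real (T.1 '' (p ⁻¹' {i}) ∩ p ⁻¹' {j}) := by
  have hT : Measurable T.1.symm := T.2.2.measurable
  have h := sum_measureReal_preimage_singleton (μ := μ) (f := fun x => (p (T.1.symm x), p x))
    (I ×ˢ J) fun y _ => ((hp.comp hT).prodMk hp) (measurableSet_singleton y)
  rw [Finset.sum_product] at h
  convert! h.symm using 4 with i hi j hj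
  · rw [Equiv.image_eq_preimage_symm]
    ext x
    simp
  · rw [Equiv.image_eq_preimage_symm]
    ext x
    simp

lemma abs_measureReal_image_inter_sub_le (T : MPAut μ) {A A' B B' : Set X} (hA : MeasurableSet A)
    (hA' : MeasurableSet A') (hB : MeasurableSet B) (hB' : MeasurableSet B') :
    |μ.real (T.1 '' A ∩ B) - μ.real (T.1 '' A' ∩ B')| ≤ μ.real (A ∆ A') + μ.real (B ∆ B') := by
  have hm := MPAut.measurableSet_image T hA
  have hm' := MPAut.measurableSet_image T hA'
  refine (abs_measureReal_sub_le_measureReal_symmDiff (hm.inter hB).nullMeasurableSet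
    (hm'.inter hB').nullMeasurableSet).trans ?_
  have h1 : μ.real (T.1 '' (A ∆ A')) = μ.real (A ∆ A') :=
    congrArg ENNReal.toReal (MPAut.measure_image T (hA.symmDiff hA'))
  rw [← h1, Set.image_symmDiff T.1.injective]
  refine (measureReal_mono ?_).trans (measureReal_union_le _ _)
  intro x hx
  simp only [mem_symmDiff, mem_inter_iff, mem_union] at hx ⊢
  tauto

lemma exists_partition_factor {ι : Type*} [Finite ι] [Nonempty ι] [MeasurableSpace ι]
    [DiscreteMeasurableSpace ι] {r : X → ι} (hr : Measurable r) :
    ∃ (k : ℕ) (p : {p : X → Fin (k + 1) // Measurable p}) (f : Fin (k + 1) → ι),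
      ∀ x, f (p.1 x) = r x := by
  obtain ⟨n, ⟨e⟩⟩ := Finite.exists_equiv_fin ι
  obtain ⟨k, rfl⟩ : ∃ k, n = k + 1 := Nat.exists_eq_succ_of_ne_zero fun h => by
    subst h
    exact (e (Classical.arbitrary ι)).elim0
  exact ⟨k, ⟨e ∘ r, (measurable_of_finite e).comp hr⟩, e.symm, fun x => e.symm_apply_apply _⟩

variable {Γ : Type*} [Group Γ]

namespace ActionSpace

/-- The statistics of a partition depend continuously on those of any finer partition. -/
lemma exists_continuous_stat_eq {Δ Δ' : Finset Γ} (hΔ : Δ ⊆ Δ') {k k' : ℕ}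
    (p : {p : X → Fin (k + 1) // Measurable p}) (p' : {p : X → Fin (k' + 1) // Measurable p})
    (f : Fin (k' + 1) → Fin (k + 1)) (hf : ∀ x, f (p'.1 x) = p.1 x) :
    ∃ Φ : (Δ' → Fin (k' + 1) → Fin (k' + 1) → ℝ) → (Δ → Fin (k + 1) → Fin (k + 1) → ℝ),
      Continuous Φ ∧ ∀ a : ActionSpace Γ μ, stat Δ k p a = Φ (stat Δ' k' p' a) := by
  refine ⟨fun s γ i j => ∑ i' with f i' = i, ∑ j' with f j' = j, s ⟨γ.1, hΔ γ.2⟩ i' j',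
    by fun_prop, ?_⟩
  rintro ⟨a⟩
  ext γ i j
  refine Eq.trans ?_ (measureReal_image_inter_preimage (a γ) p'.2 _ _)
  change μ.real ((a γ).1 '' (p.1 ⁻¹' {i}) ∩ p.1 ⁻¹' {j}) = _
  have h : ∀ i, p.1 ⁻¹' {i} = p'.1 ⁻¹' ((Finset.univ.filter fun i' => f i' = i : Finset _) : Set _) := by
    intro i
    ext x
    simp [← hf x]
  rw [h, h]

lemma exists_continuous_dist_move_eq (γ : Γ) (B : MeasuredSets μ) (a : ActionSpace Γ μ) :
    ∃ (k : ℕ) (p : {p : X → Fin (k + 1) // Measurable p})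
      (Φ : (({γ} : Finset Γ) → Fin (k + 1) → Fin (k + 1) → ℝ) → ℝ),
      Continuous Φ ∧ ∀ c : ActionSpace Γ μ, dist (move γ B c) (move γ B a) = Φ (stat {γ} k p c) := by
  classical
  obtain ⟨a⟩ := a
  set D := MPAut.image (a γ) B with hD
  obtain ⟨k, p, f, hf⟩ := exists_partition_factor (r := fun x => (x ∈ B.1, x ∈ D.1))
    ((measurableSet_setOfPred.1 B.2).prodMk (measurableSet_setOfPred.1 D.2))
  -- As `γ^c B` and `D` both have measure `μ B`, their symmetric difference has measure `2 (μ B - μ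
  -- (γ^c B ∩ D))`, and `p` refines both `B` and `D`.
  refine ⟨k, p, fun s => 2 * (μ.real B.1 - ∑ i with (f i).1, ∑ j with (f j).2,
    s ⟨γ, Finset.mem_singleton_self γ⟩ i j), by fun_prop, ?_⟩
  rintro ⟨c⟩
  have h := measureReal_image_inter_preimage (c γ) p.2 {i | (f i).1} {j | (f j).2}
  have hB : p.1 ⁻¹' (({i | (f i).1} : Finset (Fin (k + 1))) : Set (Fin (k + 1))) = B.1 := by
    ext x
    simp [hf x]
  have hD' : p.1 ⁻¹' (({i | (f i).2} : Finset (Fin (k + 1))) : Set (Fin (k + 1))) = D.1 := by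
    ext x
    simp [hf x]
  rw [hB, hD'] at h
  have hdist : dist (move γ B (mk c)) (move γ B (mk a)) = μ.real (((c γ).1 '' B.1) ∆ D.1) := rfl
  refine hdist.trans (Eq.trans ?_ (congrArg (fun t => 2 * (μ.real B.1 - t)) h))
  have hm := MPAut.measurableSet_image (c γ) B.2
  have h1 : μ.real ((c γ).1 '' B.1) = μ.real B.1 :=
    congrArg ENNReal.toReal (MPAut.measure_image (c γ) B.2)
  have h2 : μ.real D.1 = μ.real B.1 := congrArg ENNReal.toReal (MPAut.measure_image (a γ) B.2)
  rw [measureReal_symmDiff_eq hm D.2]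
  have h3 := measureReal_sdiff_add_inter (μ := μ) (s := (c γ).1 '' B.1) D.2
  have h4 := measureReal_sdiff_add_inter (μ := μ) (s := D.1) hm
  rw [inter_comm] at h4
  linarith

/-- Basic neighborhoods of an action are given by the statistics of a single partition. -/
lemma exists_mem_nhds_stat {V : Set (ActionSpace Γ μ)} {a : ActionSpace Γ μ} (hV : V ∈ 𝓝 a) :
    ∃ (Δ : Finset Γ) (k : ℕ) (p : {p : X → Fin (k + 1) // Measurable p}), 1 ∈ Δ ∧
      ∃ U ∈ 𝓝 (stat Δ k p a), ∀ c, stat Δ k p c ∈ U → c ∈ V := by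
  classical
  let ι := Finset Γ × Σ k : ℕ, {p : X → Fin (k + 1) // Measurable p}
  let F : ι → Filter (ActionSpace Γ μ) := fun i =>
    Filter.comap (stat i.1 i.2.1 i.2.2) (𝓝 (stat i.1 i.2.1 i.2.2 a))
  have hF : ∀ (i j : ι), i.1 ⊆ j.1 →
      (∃ f : Fin (j.2.1 + 1) → Fin (i.2.1 + 1), ∀ x, f (j.2.2.1 x) = i.2.2.1 x) → F j ≤ F i := by
    rintro i j hij ⟨f, hf⟩
    obtain ⟨Φ, hΦ, h⟩ := exists_continuous_stat_eq (μ := μ) hij i.2.2 j.2.2 f hf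
    refine Filter.tendsto_iff_comap.1 ?_
    have h' : stat i.1 i.2.1 i.2.2 = Φ ∘ (stat j.1 j.2.1 j.2.2 : ActionSpace Γ μ → _) := funext h
    rw [h']
    exact (hΦ.tendsto _).comp Filter.tendsto_comap
  -- Common refinements make the family directed, so one partition replaces finitely many
  -- conditions.
  have hdir : Directed (· ≥ ·) F := by
    rintro i j
    obtain ⟨k, p, f, hf⟩ := exists_partition_factor (i.2.2.2.prodMk j.2.2.2)
    exact ⟨⟨i.1 ∪ j.1, k, p⟩,
      hF i _ Finset.subset_union_left ⟨fun t => (f t).1, fun x => congrArg Prod.fst (hf x)⟩,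
      hF j _ Finset.subset_union_right ⟨fun t => (f t).2, fun x => congrArg Prod.snd (hf x)⟩⟩
  have hle : ⨅ i, F i ≤ 𝓝 a := by
    rw [nhds_iInf]
    refine le_iInf fun γ => ?_
    rw [nhds_iInf]
    refine le_iInf fun B => ?_
    rw [nhds_induced]
    refine Filter.tendsto_iff_comap.1 (tendsto_iff_dist_tendsto_zero.2 ?_)
    obtain ⟨k, p, Φ, hΦ, h⟩ := exists_continuous_dist_move_eq γ B a
    simp_rw [h]
    have h0 : Φ (stat {γ} k p a) = 0 := by rw [← h, dist_self]
    rw [← h0]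
    exact ((hΦ.tendsto _).comp Filter.tendsto_comap).mono_left (iInf_le F ⟨{γ}, k, p⟩)
  have : Nonempty ι := ⟨⟨∅, 0, fun _ => 0, measurable_const⟩⟩
  obtain ⟨i, hi⟩ := (Filter.mem_iInf_of_directed hdir V).1 (hle hV)
  obtain ⟨U, hU, hUV⟩ := hF i ⟨insert 1 i.1, i.2⟩ (Finset.subset_insert _ _) ⟨id, fun _ => rfl⟩ hi
  exact ⟨insert 1 i.1, i.2.1, i.2.2, Finset.mem_insert_self _ _, U, hU, fun c hc => hUV hc⟩

/-- The entries at the identity are `μ (B_i ∩ B_j)`, so the statistics know the sizes of the pieces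
as soon as `1 ∈ Δ`. -/
lemma measureReal_preimage_eq_sum_stat {Δ : Finset Γ} (h1 : 1 ∈ Δ) {k : ℕ}
    (q : {p : X → Fin (k + 1) // Measurable p}) (b : ActionSpace Γ μ) (I : Finset (Fin (k + 1))) :
    μ.real (q.1 ⁻¹' I) = ∑ i ∈ I, ∑ j, stat Δ k q b ⟨1, h1⟩ i j := by
  obtain ⟨b⟩ := b
  refine Eq.trans ?_ (measureReal_image_inter_preimage (b 1) q.2 I Finset.univ)
  rw [map_one, Finset.coe_univ, preimage_univ, inter_univ]
  congr 1
  exact (image_id _).symm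

lemma stat_mem_statSet (Δ : Finset Γ) (k : ℕ) (p : {p : X → Fin (k + 1) // Measurable p})
    (a : ActionSpace Γ μ) : stat Δ k p a ∈ statSet Δ k a :=
  subset_closure ⟨p, rfl⟩

lemma exists_stat_mem {Δ : Finset Γ} {k : ℕ} {a : ActionSpace Γ μ}
    {U : Set (Δ → Fin (k + 1) → Fin (k + 1) → ℝ)} (hU : IsOpen U)
    (h : ((statSet Δ k a : Set _) ∩ U).Nonempty) : ∃ p, stat Δ k p a ∈ U := by
  obtain ⟨s, hs, hsU⟩ := h
  obtain ⟨_, ht, p, rfl⟩ := mem_closure_iff.1 hs U hU hsU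
  exact ⟨p, ht⟩

variable [StandardBorelSpace X] [NullSingletonClass μ]

/-- If the statistics of some partition under `b` are close enough to those of a fixed partition
under `a`, then a conjugate of `b` is close to `a`. -/
lemma exists_smul_mem_of_stat {V : Set (ActionSpace Γ μ)} {a : ActionSpace Γ μ} (hV : V ∈ 𝓝 a) :
    ∃ (Δ : Finset Γ) (k : ℕ) (p : {p : X → Fin (k + 1) // Measurable p}),
      ∃ U ∈ 𝓝 (stat Δ k p a), ∀ (b : ActionSpace Γ μ) (q : {p : X → Fin (k + 1) // Measurable p}),
        stat Δ k q b ∈ U → ∃ T : MPAut μ, T • b ∈ V := by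
  obtain ⟨Δ, k, p, h1, U, hU, hUV⟩ := exists_mem_nhds_stat hV
  obtain ⟨ε, hε, hεU⟩ := Metric.mem_nhds_iff.1 hU
  set s₀ := stat Δ k p a with hs₀
  -- `M s I` is the total mass of the pieces indexed by `I`, read off from `s`; `η s i` is then the
  -- error allowed by `exists_mpAut_measureReal_symmDiff_le`.
  let M : (Δ → Fin (k + 1) → Fin (k + 1) → ℝ) → Finset (Fin (k + 1)) → ℝ :=
    fun s I => ∑ i ∈ I, ∑ j, s ⟨1, h1⟩ i j
  let η : (Δ → Fin (k + 1) → Fin (k + 1) → ℝ) → Fin (k + 1) → ℝ := fun s i =>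
    |M s (Finset.Iio i) - M s₀ (Finset.Iio i)| + |M s (Finset.Iic i) - M s₀ (Finset.Iic i)|
  have hU' : ∀ᶠ s in 𝓝 s₀, ∀ γ i j, η s i + η s j + |s γ i j - s₀ γ i j| < ε := by
    rw [Filter.eventually_all]
    intro γ
    rw [Filter.eventually_all]
    intro i
    rw [Filter.eventually_all]
    intro j
    have hc : Continuous fun s => η s i + η s j + |s γ i j - s₀ γ i j| := by fun_prop
    refine (hc.tendsto s₀).eventually (gt_mem_nhds ?_)
    simpa [η] using hε
  refine ⟨Δ, k, p, _, hU', fun b q hq => ?_⟩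
  obtain ⟨T, hT⟩ := exists_mpAut_measureReal_symmDiff_le μ p.2 q.2
  refine ⟨T, hUV _ (hεU ?_)⟩
  have hη : ∀ i, μ.real ({x | p.1 (T.1 x) = i} ∆ {x | q.1 x = i}) ≤ η (stat Δ k q b) i := by
    intro i
    refine (hT i).trans (le_of_eq ?_)
    simp only [η, M, hs₀]
    rw [← measureReal_preimage_eq_sum_stat h1 q b, ← measureReal_preimage_eq_sum_stat h1 q b,
      ← measureReal_preimage_eq_sum_stat h1 p a, ← measureReal_preimage_eq_sum_stat h1 p a]
    simp only [Finset.coe_Iio, Finset.coe_Iic]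
    rfl
  rw [Metric.mem_ball, stat_smul]
  refine (dist_pi_lt_iff hε).2 fun γ => (dist_pi_lt_iff hε).2 fun i => (dist_pi_lt_iff hε).2
    fun j => ?_
  -- Compare `p ∘ T` with `q` under `b`, at cost `η i + η j`, and then `q` under `b` with `p` under
  -- `a`.
  refine lt_of_le_of_lt ((dist_triangle _ (stat Δ k q b γ i j) _).trans
    (add_le_add ?_ le_rfl)) (hq γ i j)
  have hb : |stat Δ k ⟨p.1 ∘ T.1, p.2.comp T.2.1.measurable⟩ b γ i j - stat Δ k q b γ i j| ≤
      μ.real ({x | p.1 (T.1 x) = i} ∆ {x | q.1 x = i}) +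
        μ.real ({x | p.1 (T.1 x) = j} ∆ {x | q.1 x = j}) := by
    obtain ⟨b⟩ := b
    have hpT : Measurable (p.1 ∘ T.1) := p.2.comp T.2.1.measurable
    exact abs_measureReal_image_inter_sub_le (b γ) (hpT (measurableSet_singleton i))
      (q.2 (measurableSet_singleton i)) (hpT (measurableSet_singleton j))
      (q.2 (measurableSet_singleton j))
  exact hb.trans (add_le_add (hη i) (hη j))

theorem le_iff_forall_statSet_subset {a b : ActionSpace Γ μ} :
    a ≤ b ↔ ∀ (Δ : Finset Γ) (k : ℕ),
      (statSet Δ k a : Set (Δ → Fin (k + 1) → Fin (k + 1) → ℝ)) ⊆ statSet Δ k b := by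
  refine ⟨fun h Δ k => statSet_mono Δ k h, fun h => mem_closure_iff_nhds.2 fun V hV => ?_⟩
  obtain ⟨Δ, k, p, U, hU, hUV⟩ := exists_smul_mem_of_stat hV
  obtain ⟨q, hq⟩ := exists_stat_mem isOpen_interior
    ⟨_, h Δ k (stat_mem_statSet Δ k p a), mem_interior_iff_mem_nhds.2 hU⟩
  obtain ⟨T, hT⟩ := hUV b q (interior_subset hq)
  exact ⟨T • b, hT, T, rfl⟩

end ActionSpace

end Statistics

/-! ### Approximating measurable partitions by clopen ones -/

section ClopenApproximation

variable {Z : Type*} [TopologicalSpace Z] [CompactSpace Z] [T2Space Z] [TotallyDisconnectedSpace Z]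
  [SecondCountableTopology Z] [MeasurableSpace Z] [BorelSpace Z]

lemma exists_isClopen_measureReal_symmDiff_lt (ν : Measure Z) [IsProbabilityMeasure ν] {S : Set Z}
    (hS : MeasurableSet S) {ε : ℝ} (hε : 0 < ε) : ∃ C, IsClopen C ∧ ν.real (C ∆ S) < ε := by
  obtain ⟨C, hC, h⟩ := exists_measure_symmDiff_lt_of_generateFrom_isSetRing (μ := ν)
    (C := {s : Set Z | IsClopen s})
    ⟨isClopen_empty, fun _ _ => IsClopen.union, fun _ _ => IsClopen.diff⟩
    ⟨{univ}, countable_singleton _, by simp [isClopen_univ], by simp⟩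
    (BorelSpace.measurable_eq.trans isTopologicalBasis_isClopen.borel_eq_generateFrom)
    hS (ENNReal.ofReal_pos.2 hε)
  exact ⟨C, hC, (ENNReal.toReal_lt_of_lt_ofReal h)⟩

lemma exists_continuous_measureReal_symmDiff_le (ν : Measure Z) [IsProbabilityMeasure ν] {k : ℕ}
    {r : Z → Fin (k + 1)} (hr : Measurable r) {ε : ℝ} (hε : 0 < ε) :
    ∃ c : Z → Fin (k + 1), Continuous c ∧ ∀ i, ν.real ((c ⁻¹' {i}) ∆ (r ⁻¹' {i})) ≤ ε := by
  classical
  choose C hC hCε using fun i => exists_isClopen_measureReal_symmDiff_lt ν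
    (hr (measurableSet_singleton i)) (div_pos hε (Nat.cast_add_one_pos (α := ℝ) k))
  -- The sets `C i` need not form a partition: `g` decodes a membership pattern that selects exactly
  -- one index and sends any other to `0`. Errors occur only in the union of the sets `C i ∆ r ⁻¹'
  -- {i}`.
  let g : (Fin (k + 1) → Bool) → Fin (k + 1) := fun v =>
    if h : ∃ l, v = fun i => decide (l = i) then h.choose else 0
  have hg : ∀ l, g (fun i => decide (l = i)) = l := by
    intro l
    have h : ∃ l', (fun i => decide (l = i)) = fun i => decide (l' = i) := ⟨l, rfl⟩
    have h' := congrFun h.choose_spec l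
    simp only [g, dif_pos h]
    simpa using h'
  refine ⟨fun z => g fun i => (C i).boolIndicator z, (continuous_of_discreteTopology (f := g)).comp
    (continuous_pi fun i => (continuous_boolIndicator_iff_isClopen _).2 (hC i)), fun i => ?_⟩
  calc ν.real _ ≤ ν.real (⋃ i, C i ∆ (r ⁻¹' {i})) := measureReal_mono ?_
    _ ≤ ∑ i, ν.real (C i ∆ (r ⁻¹' {i})) := measureReal_iUnion_fintype_le _
    _ ≤ ∑ _i : Fin (k + 1), ε / (k + 1) := Finset.sum_le_sum fun i _ => (hCε i).le
    _ = ε := by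
      rw [Finset.sum_const, Finset.card_univ, Fintype.card_fin, nsmul_eq_mul]
      push_cast
      field_simp
  intro z hz
  by_contra hz'
  simp only [mem_iUnion, not_exists] at hz'
  have h : (fun i => (C i).boolIndicator z) = fun i => decide (r z = i) := by
    ext i
    have := hz' i
    rw [mem_symmDiff] at this
    by_cases hzi : z ∈ C i
    · have : r z = i := by
        by_contra h
        exact this (Or.inl ⟨hzi, h⟩)
      simp [(mem_iff_boolIndicator _ _).1 hzi, this]
    · have : r z ≠ i := fun h => this (Or.inr ⟨h, hzi⟩)
      simp [(notMem_iff_boolIndicator _ _).1 hzi, this]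
  rw [mem_symmDiff] at hz
  simp only [mem_preimage, h, hg] at hz
  tauto

/-- Weak limits of measures control only clopen sets, so the statistics of a limit action must be
tested on continuous partitions alone; these are dense. -/
lemma ActionSpace.statSet_subset_of_continuous {Γ : Type*} [Group Γ] {ν : Measure Z}
    [IsProbabilityMeasure ν] {α : ActionSpace Γ ν} {Δ : Finset Γ} {k : ℕ}
    {K : Set (Δ → Fin (k + 1) → Fin (k + 1) → ℝ)} (hK : IsClosed K)
    (h : ∀ (c : Z → Fin (k + 1)) (hc : Continuous c), stat Δ k ⟨c, hc.measurable⟩ α ∈ K) :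
    (statSet Δ k α : Set _) ⊆ K := by
  refine closure_minimal ?_ hK
  rintro _ ⟨r, rfl⟩
  rw [← hK.closure_eq]
  refine Metric.mem_closure_iff.2 fun ε hε => ?_
  obtain ⟨c, hc, hcε⟩ := exists_continuous_measureReal_symmDiff_le ν r.2 (ε := ε / 4) (by linarith)
  refine ⟨_, h c hc, ?_⟩
  rw [dist_comm]
  obtain ⟨α⟩ := α
  refine (dist_pi_lt_iff hε).2 fun γ => (dist_pi_lt_iff hε).2 fun i => (dist_pi_lt_iff hε).2
    fun j => ?_
  refine lt_of_le_of_lt (abs_measureReal_image_inter_sub_le (α γ)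
    (hc.measurable (measurableSet_singleton i)) (r.2 (measurableSet_singleton i))
    (hc.measurable (measurableSet_singleton j)) (r.2 (measurableSet_singleton j))) ?_
  linarith [hcε i, hcε j]

end ClopenApproximation

/-! ### Transport of actions along isomorphisms -/

section Transport

variable {X Z : Type*} [MeasurableSpace X] [MeasurableSpace Z] {μ : Measure X} {ν : Measure Z}

/-- An isomorphism of measure spaces induces an isomorphism of automorphism groups. -/
def MPAut.congr (e : Z ≃ᵐ X) (he : MeasurePreserving e ν μ) : MPAut ν →* MPAut μ where
  toFun T := ⟨(e.toEquiv.symm.trans T.1).trans e.toEquiv,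
    he.comp (T.2.1.comp (he.symm e)), he.comp (T.2.2.comp (he.symm e))⟩
  map_one' := by
    ext x
    exact e.apply_symm_apply x
  map_mul' S T := by
    ext x
    change e (S.1 (T.1 (e.symm x))) = e (S.1 (e.symm (e (T.1 (e.symm x)))))
    rw [e.symm_apply_apply]

variable {Γ : Type*} [Group Γ]

lemma ActionSpace.stat_congr (e : Z ≃ᵐ X) (he : MeasurePreserving e ν μ) (α : Γ →* MPAut ν)
    (Δ : Finset Γ) (k : ℕ) (p : {p : X → Fin (k + 1) // Measurable p}) :
    stat Δ k p (mk ((MPAut.congr e he).comp α)) =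
      stat Δ k ⟨p.1 ∘ e, p.2.comp e.measurable⟩ (mk α) := by
  ext γ i j
  change μ.real ((MPAut.congr e he (α γ)).1 '' (p.1 ⁻¹' {i}) ∩ p.1 ⁻¹' {j}) =
    ν.real ((α γ).1 '' (e ⁻¹' (p.1 ⁻¹' {i})) ∩ e ⁻¹' (p.1 ⁻¹' {j}))
  have hi := p.2 (measurableSet_singleton i)
  have hj := p.2 (measurableSet_singleton j)
  have hm := (MPAut.measurableSet_image (MPAut.congr e he (α γ)) hi).inter hj
  refine (congrArg ENNReal.toReal (he.measure_preimage hm.nullMeasurableSet)).symm.trans ?_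
  rw [measureReal_def]
  congr 2
  ext z
  rw [Equiv.image_eq_preimage_symm, Equiv.image_eq_preimage_symm]
  change p.1 (e ((α γ).1.symm (e.symm (e z)))) = i ∧ p.1 (e z) = j ↔ _
  rw [e.symm_apply_apply]
  rfl

variable [IsProbabilityMeasure μ] [IsProbabilityMeasure ν]

lemma ActionSpace.statSet_congr (e : Z ≃ᵐ X) (he : MeasurePreserving e ν μ) (α : Γ →* MPAut ν)
    (Δ : Finset Γ) (k : ℕ) :
    statSet Δ k (mk ((MPAut.congr e he).comp α)) = statSet Δ k (mk α) := by
  refine SetLike.coe_injective (congrArg closure (Subset.antisymm ?_ ?_))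
  · rintro _ ⟨p, rfl⟩
    exact ⟨_, (stat_congr e he α Δ k p).symm⟩
  · rintro _ ⟨r, rfl⟩
    refine ⟨⟨r.1 ∘ e.symm, r.2.comp e.symm.measurable⟩, ?_⟩
    refine (stat_congr e he α Δ k _).trans ?_
    congr 2
    ext z
    simp

lemma exists_measurableEquiv_measurePreserving [StandardBorelSpace X] [StandardBorelSpace Z]
    [NullSingletonClass μ] [NullSingletonClass ν] : ∃ e : Z ≃ᵐ X, MeasurePreserving e ν μ := by
  -- With a one-piece partition only the isomorphism with the unit interval remains.
  obtain ⟨f, hf, -⟩ := exists_measurableEquiv_real μ (measurable_const (a := (0 : Fin 1)))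
  obtain ⟨e, he, -⟩ := exists_measurableEquiv_real ν (measurable_const (a := (0 : Fin 1)))
  exact ⟨e.trans f.symm, (hf.symm f).comp he⟩

end Transport

/-! ### Limits of actions as shift actions -/

section Shift

/-- The space of families, indexed by `Γ`, of simultaneous values of a family of partitions. -/
abbrev ShiftSpace (Γ : Type*) {J : Type*} (k : J → ℕ) := Γ → ∀ j, Fin (k j + 1)

variable {Γ J : Type*} [Group Γ] {k : J → ℕ}

/-- The shift action of `Γ`. -/
def shift (δ : Γ) : Equiv.Perm (ShiftSpace Γ k) where
  toFun z γ := z (δ⁻¹ * γ)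
  invFun z γ := z (δ * γ)
  left_inv z := by
    ext γ
    simp
  right_inv z := by
    ext γ
    simp

lemma continuous_shift (δ : Γ) : Continuous (shift δ : ShiftSpace Γ k → ShiftSpace Γ k) :=
  continuous_pi fun _ => continuous_apply _

lemma shift_symm (δ : Γ) : (shift δ : Equiv.Perm (ShiftSpace Γ k)).symm = shift δ⁻¹ := by
  ext z γ
  simp [shift]

/-- The shift action with respect to an invariant measure. -/
def shiftAction (ν : Measure (ShiftSpace Γ k)) (h : ∀ δ, MeasurePreserving (shift δ) ν ν) :
    Γ →* MPAut ν where
  toFun δ := ⟨shift δ, h δ, shift_symm (k := k) δ ▸ h δ⁻¹⟩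
  map_one' := by
    ext z γ
    simp [shift]
  map_mul' δ ε := by
    ext z γ
    simp [shift, mul_assoc]

variable {X : Type*} [MeasurableSpace X] {μ : Measure X}

/-- The map recording the itinerary of a point with respect to a family of partitions. -/
def itinerary (a : Γ →* MPAut μ) (P : ∀ j, {p : X → Fin (k j + 1) // Measurable p}) (x : X) :
    ShiftSpace Γ k :=
  fun γ j => (P j).1 ((a γ).1.symm x)

lemma measurable_itinerary (a : Γ →* MPAut μ) (P : ∀ j, {p : X → Fin (k j + 1) // Measurable p}) :
    Measurable (itinerary a P) :=
  measurable_pi_lambda _ fun γ => measurable_pi_lambda _ fun j =>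
    (P j).2.comp (a γ).2.2.measurable

lemma itinerary_apply (a : Γ →* MPAut μ) (P : ∀ j, {p : X → Fin (k j + 1) // Measurable p})
    (δ : Γ) (x : X) : itinerary a P ((a δ).1 x) = shift δ (itinerary a P x) := by
  ext γ j
  change ((P j).1 ((a γ).1.symm ((a δ).1 x)) : ℕ) = (P j).1 ((a (δ⁻¹ * γ)).1.symm x)
  have h : a (δ⁻¹ * γ) = (a δ)⁻¹ * a γ := by rw [map_mul, map_inv]
  rw [h]
  rfl

lemma itinerary_one (a : Γ →* MPAut μ) (P : ∀ j, {p : X → Fin (k j + 1) // Measurable p})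
    (j : J) (x : X) : itinerary a P x 1 j = (P j).1 x := by
  change (P j).1 ((a 1).1.symm x) = _
  rw [map_one]
  rfl

variable [IsProbabilityMeasure μ] [Countable Γ] [Countable J]

/-- Every family of actions with partitions has, along an ultrafilter, a limit that is a shift
action: the statistics of continuous partitions converge. -/
theorem exists_shiftAction_tendsto_stat {I : Type*} (F : Ultrafilter I) (a : I → Γ →* MPAut μ)
    (P : I → ∀ j, {p : X → Fin (k j + 1) // Measurable p}) :
    ∃ (ν : Measure (ShiftSpace Γ k)) (_ : IsProbabilityMeasure ν)
      (h : ∀ δ, MeasurePreserving (shift δ) ν ν),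
      ∀ (Δ : Finset Γ) (l : ℕ) (c : ShiftSpace Γ k → Fin (l + 1)) (hc : Continuous c),
        Filter.Tendsto (fun i => ActionSpace.stat Δ l
          ⟨c ∘ itinerary (a i) (P i), hc.measurable.comp (measurable_itinerary _ _)⟩
          (ActionSpace.mk (a i))) F
          (𝓝 (ActionSpace.stat Δ l ⟨c, hc.measurable⟩ (ActionSpace.mk (shiftAction ν h)))) := by
  let μ' : ProbabilityMeasure X := ⟨μ, inferInstance⟩
  let N : I → ProbabilityMeasure (ShiftSpace Γ k) := fun i =>
    μ'.map (measurable_itinerary (a i) (P i)).aemeasurable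
  obtain ⟨ν, -, hν⟩ := isCompact_univ.ultrafilter_le_nhds (F.map N) (by simp)
  have hν' : Filter.Tendsto N F (𝓝 ν) := hν
  have hinv : ∀ δ, MeasurePreserving (shift δ) (ν : Measure (ShiftSpace Γ k)) ν := by
    intro δ
    refine ⟨(continuous_shift δ).measurable, ?_⟩
    have h1 := ProbabilityMeasure.tendsto_map_of_tendsto_of_continuous N ν hν' (continuous_shift δ)
    -- Itineraries are equivariant and `a i` preserves `μ`, so each law is already shift invariant.
    have h2 : (fun i => (N i).map (continuous_shift δ).measurable.aemeasurable) = N := by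
      ext1 i
      refine Subtype.ext ?_
      change (μ.map (itinerary (a i) (P i))).map (shift δ) = μ.map (itinerary (a i) (P i))
      rw [Measure.map_map (continuous_shift δ).measurable (measurable_itinerary _ _)]
      have h3 : shift δ ∘ itinerary (a i) (P i) = itinerary (a i) (P i) ∘ (a i δ).1 :=
        funext fun x => (itinerary_apply _ _ _ _).symm
      rw [h3, ← Measure.map_map (measurable_itinerary _ _) (a i δ).2.1.measurable,
        (a i δ).2.1.map_eq]
    rw [h2] at h1
    have h4 := tendsto_nhds_unique h1 hν'
    exact congrArg (fun ρ : ProbabilityMeasure (ShiftSpace Γ k) => (ρ : Measure (ShiftSpace Γ k))) h4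
  refine ⟨ν, inferInstance, hinv, fun Δ l c hc => ?_⟩
  refine tendsto_pi_nhds.2 fun γ => tendsto_pi_nhds.2 fun i => tendsto_pi_nhds.2 fun j => ?_
  -- Clopen sets have empty boundary, so weak convergence gives convergence of their measures.
  have hC : IsClopen (shift γ.1 '' (c ⁻¹' {i}) ∩ c ⁻¹' {j}) := by
    rw [Equiv.image_eq_preimage_symm, shift_symm]
    exact (((isClopen_discrete {i}).preimage hc).preimage (continuous_shift _)).inter
      ((isClopen_discrete {j}).preimage hc)
  have h := ProbabilityMeasure.tendsto_measure_of_isClopen_of_tendsto hν' hC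
  have h' := (NNReal.continuous_coe.tendsto _).comp h
  refine Filter.Tendsto.congr (fun n => ?_) h'
  change (μ.map (itinerary (a n) (P n))).real (shift γ.1 '' (c ⁻¹' {i}) ∩ c ⁻¹' {j}) =
    μ.real ((a n γ).1 '' ((c ∘ itinerary (a n) (P n)) ⁻¹' {i}) ∩ (c ∘ itinerary (a n) (P n)) ⁻¹' {j})
  rw [map_measureReal_apply (measurable_itinerary _ _) hC.1.measurableSet]
  congr 1
  ext x
  rw [Equiv.image_eq_preimage_symm, Equiv.image_eq_preimage_symm]
  have h3 : (shift γ.1).symm (itinerary (a n) (P n) x) =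
      itinerary (a n) (P n) ((a n γ).1.symm x) := by
    rw [Equiv.symm_apply_eq, ← itinerary_apply, Equiv.apply_symm_apply]
  simp [h3]

end Shift

/-! ### Closedness of inclusion in the hyperspace -/

section NonemptyCompacts

open TopologicalSpace

variable {E : Type*} [TopologicalSpace E] [T2Space E]

lemma isClosed_setOfPred_le_nonemptyCompacts :
    IsClosed {K : NonemptyCompacts E × NonemptyCompacts E | K.1 ≤ K.2} := by
  simp_rw [← sup_eq_right]
  exact isClosed_eq continuous_sup continuous_snd

lemma mem_of_tendsto_nonemptyCompacts {I : Type*} {F : Filter I} [F.NeBot] {s : I → E} {x : E}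
    {K : I → NonemptyCompacts E} {L : NonemptyCompacts E} (hs : Filter.Tendsto s F (𝓝 x))
    (hK : Filter.Tendsto K F (𝓝 L)) (h : ∀ i, s i ∈ K i) : x ∈ L := by
  have h1 : Filter.Tendsto (fun i => ({s i} : NonemptyCompacts E)) F (𝓝 {x}) :=
    (NonemptyCompacts.continuous_singleton.tendsto x).comp hs
  have h2 := isClosed_setOfPred_le_nonemptyCompacts.mem_of_tendsto (h1.prodMk_nhds hK)
    (Filter.Eventually.of_forall fun i => by
      change (({s i} : NonemptyCompacts E) : Set E) ⊆ K i
      simpa using h i)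
  have h3 : (({x} : NonemptyCompacts E) : Set E) ⊆ L := h2
  simpa using h3

end NonemptyCompacts

/-! ### Compactness of the space of statistics -/

section Compactness

variable {X : Type*} [MeasurableSpace X] [StandardBorelSpace X] {μ : Measure X}
  [IsProbabilityMeasure μ] [NullSingletonClass μ] {Γ : Type*} [Group Γ]

lemma exists_partition_measureReal_le (μ : Measure X) [IsProbabilityMeasure μ]
    [NullSingletonClass μ] (n : ℕ) :
    ∃ U : {p : X → Fin (n + 1) // Measurable p}, ∀ l, μ.real (U.1 ⁻¹' {l}) ≤ 1 / ((n : ℝ) + 1) := by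
  obtain ⟨e, he, -⟩ := exists_measurableEquiv_real μ (measurable_const (a := (0 : Fin 1)))
  have hn : (0 : ℝ) < n + 1 := by positivity
  -- The truncation only makes the index land in `Fin (n + 1)`; it is inactive for `e x` in `(0,
  -- 1)`, hence almost everywhere.
  let f : ℕ → Fin (n + 1) := fun m => ⟨min m n, by omega⟩
  let U : X → Fin (n + 1) := fun x => f ⌊((n : ℝ) + 1) * e x⌋₊
  have hU : Measurable U :=
    (measurable_from_top (f := f)).comp (Nat.measurable_floor.comp (e.measurable.const_mul _))
  refine ⟨⟨U, hU⟩, fun l => ?_⟩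
  have h01 : ∀ᵐ x ∂μ, e x ∈ Ioo (0 : ℝ) 1 :=
    he.quasiMeasurePreserving.ae (ae_restrict_mem measurableSet_Ioo)
  have hsub : (U ⁻¹' {l} : Set X) ≤ᵐ[μ] e ⁻¹' Icc ((l : ℝ) / (n + 1)) (((l : ℝ) + 1) / (n + 1)) := by
    filter_upwards [h01] with x hx hxl
    have h0 : 0 ≤ ((n : ℝ) + 1) * e x := mul_nonneg hn.le hx.1.le
    have hfl : ⌊((n : ℝ) + 1) * e x⌋₊ < n + 1 := by
      rw [Nat.floor_lt h0]
      push_cast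
      exact mul_lt_of_lt_one_right hn hx.2
    have hl : ⌊((n : ℝ) + 1) * e x⌋₊ = l := by
      have h := congrArg Fin.val (show U x = l from hxl)
      simp only [U, f] at h
      omega
    rw [Nat.floor_eq_iff h0] at hl
    exact ⟨(div_le_iff₀' hn).2 hl.1, (le_div_iff₀' hn).2 hl.2.le⟩
  calc μ.real (U ⁻¹' {l})
      ≤ μ.real (e ⁻¹' Icc ((l : ℝ) / (n + 1)) (((l : ℝ) + 1) / (n + 1))) :=
        ENNReal.toReal_mono (measure_ne_top _ _) (measure_mono_ae hsub)
    _ = (volume.restrict (Ioo 0 1)).real (Icc ((l : ℝ) / (n + 1)) (((l : ℝ) + 1) / (n + 1))) :=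
        congrArg ENNReal.toReal (he.measure_preimage measurableSet_Icc.nullMeasurableSet)
    _ ≤ volume.real (Icc ((l : ℝ) / (n + 1)) (((l : ℝ) + 1) / (n + 1))) :=
        ENNReal.toReal_mono (by simp) (Measure.restrict_apply_le _ _)
    _ = 1 / ((n : ℝ) + 1) := by
        rw [Real.volume_real_Icc_of_le (by gcongr; linarith)]
        ring

open TopologicalSpace in
/-- The statistics of actions on an atomless standard probability space converge along every
ultrafilter to those of some action. -/
theorem exists_tendsto_statSet [Countable Γ] {I : Type*} (F : Ultrafilter I)
    (a : I → Γ →* MPAut μ) :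
    ∃ b : ActionSpace Γ μ, ∀ (Δ : Finset Γ) (k : ℕ),
      Filter.Tendsto (fun i => ActionSpace.statSet Δ k (ActionSpace.mk (a i))) F
        (𝓝 (ActionSpace.statSet Δ k b)) := by
  have hlim : ∀ (Δ : Finset Γ) (k : ℕ),
      ∃ L : NonemptyCompacts (Δ → Fin (k + 1) → Fin (k + 1) → ℝ),
        Filter.Tendsto (fun i => ActionSpace.statSet Δ k (ActionSpace.mk (a i))) F (𝓝 L) := by
    intro Δ k
    obtain ⟨L, -, hL⟩ := (NonemptyCompacts.isCompact_subsets_of_isCompact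
      (isCompact_Icc (a := (0 : Δ → Fin (k + 1) → Fin (k + 1) → ℝ)) (b := 1))).ultrafilter_le_nhds'
      (F.map fun i => ActionSpace.statSet Δ k (ActionSpace.mk (a i)))
      (Filter.mem_map.2 (Filter.univ_mem' fun i => closure_minimal
        (by rintro _ ⟨p, rfl⟩; exact ActionSpace.stat_mem_pi Δ k p _) isClosed_Icc))
    exact ⟨L, hL⟩
  choose L hL using hlim
  have hd : ∀ (Δ : Finset Γ) (k : ℕ), ∃ d : ℕ → L Δ k, DenseRange d := fun Δ k =>
    have : Nonempty (L Δ k) := (L Δ k).nonempty.to_subtype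
    exists_dense_seq _
  choose d hd using hd
  -- The index `(Δ, k, n, m)` asks for statistics within `1 / (m + 1)` of the `n`-th point of a
  -- dense sequence in the limit set. Where no partition achieves this, a constant one is used.
  have hP : ∀ (j : Finset Γ × ℕ × ℕ × ℕ), ∃ P : I → {p : X → Fin (j.2.1 + 1) // Measurable p},
      ∀ᶠ i in F, ActionSpace.stat j.1 j.2.1 (P i) (ActionSpace.mk (a i)) ∈
        Metric.ball (d j.1 j.2.1 j.2.2.1).1 (1 / ((j.2.2.2 : ℝ) + 1)) := by
    rintro ⟨Δ, k, n, m⟩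
    have hev := (hL Δ k).eventually ((NonemptyCompacts.isOpen_inter_nonempty_of_isOpen
      (Metric.isOpen_ball (x := (d Δ k n).1) (ε := 1 / ((m : ℝ) + 1)))).mem_nhds
      ⟨_, (d Δ k n).2, Metric.mem_ball_self Nat.one_div_pos_of_nat⟩)
    have hex : ∀ i, ∃ p : {p : X → Fin (k + 1) // Measurable p},
        ((ActionSpace.statSet Δ k (ActionSpace.mk (a i)) : Set _) ∩
          Metric.ball (d Δ k n).1 (1 / ((m : ℝ) + 1))).Nonempty →
        ActionSpace.stat Δ k p (ActionSpace.mk (a i)) ∈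
          Metric.ball (d Δ k n).1 (1 / ((m : ℝ) + 1)) := by
      intro i
      by_cases h : ((ActionSpace.statSet Δ k (ActionSpace.mk (a i)) : Set _) ∩
          Metric.ball (d Δ k n).1 (1 / ((m : ℝ) + 1))).Nonempty
      · obtain ⟨p, hp⟩ := ActionSpace.exists_stat_mem Metric.isOpen_ball h
        exact ⟨p, fun _ => hp⟩
      · exact ⟨⟨fun _ => 0, measurable_const⟩, fun h' => absurd h' h⟩
    choose P hP using hex
    exact ⟨P, hev.mono fun i hi => hP i hi⟩
  choose P hP using hP
  obtain ⟨ν, hν, hinv, hlim⟩ := exists_shiftAction_tendsto_stat F a fun i j => P j i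
  set α := ActionSpace.mk (shiftAction ν hinv)
  -- Continuous partitions of the shift space pull back to partitions of `X`, so their statistics
  -- lie in the limit set; conversely the coordinate `z ↦ z 1 j` pulls back to the chosen partition
  -- `P j i`, which reaches the dense points.
  have hα : ∀ (Δ : Finset Γ) (k : ℕ), ActionSpace.statSet Δ k α = L Δ k := by
    intro Δ k
    refine SetLike.coe_injective (Subset.antisymm ?_ ?_)
    · refine ActionSpace.statSet_subset_of_continuous (L Δ k).isCompact.isClosed fun c hc => ?_
      exact mem_of_tendsto_nonemptyCompacts (hlim Δ k c hc) (hL Δ k)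
        fun i => ActionSpace.stat_mem_statSet _ _ _ _
    · have hdα : ∀ n, (d Δ k n).1 ∈ ActionSpace.statSet Δ k α := by
        intro n
        refine Metric.mem_closure_iff.2 fun ε hε => ?_
        obtain ⟨m, hm⟩ := exists_nat_one_div_lt hε
        let j : Finset Γ × ℕ × ℕ × ℕ := (Δ, k, n, m)
        have hc : Continuous fun z : ShiftSpace Γ fun j : Finset Γ × ℕ × ℕ × ℕ => j.2.1 => z 1 j :=
          (continuous_apply j).comp (continuous_apply 1)
        refine ⟨_, ⟨⟨_, hc.measurable⟩, rfl⟩, ?_⟩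
        refine lt_of_le_of_lt ?_ hm
        rw [dist_comm]
        refine Metric.mem_closedBall.1 (Metric.isClosed_closedBall.mem_of_tendsto
          (hlim Δ k _ hc) ((hP j).mono fun i hi => ?_))
        have hcomp : (fun z : ShiftSpace Γ fun j : Finset Γ × ℕ × ℕ × ℕ => j.2.1 => z 1 j) ∘
            itinerary (a i) (fun j => P j i) = (P j i).1 :=
          funext fun x => itinerary_one _ _ _ _
        refine Metric.ball_subset_closedBall ?_
        convert hi
      intro x hx
      have hx' : (⟨x, hx⟩ : L Δ k) ∈ closure (range (d Δ k)) := hd Δ k _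
      have := image_closure_subset_closure_image continuous_subtype_val (mem_image_of_mem _ hx')
      refine closure_minimal ?_ (ActionSpace.statSet Δ k α).isCompact.isClosed this
      rintro _ ⟨_, ⟨n, rfl⟩, rfl⟩
      exact hdα n
  -- Having partitions into pieces of mass at most `1 / (n + 1)` is visible in the statistics, so it
  -- survives, up to `ε / 2`, in the limit; any point lies in one of these small pieces.
  have hna : NullSingletonClass ν := by
    refine ⟨fun z => ?_⟩
    rw [← measureReal_eq_zero_iff]
    refine le_antisymm (le_of_forall_pos_lt_add fun ε hε => ?_) measureReal_nonneg
    obtain ⟨n, hn⟩ := exists_nat_one_div_lt (half_pos hε)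
    obtain ⟨U, hU⟩ := exists_partition_measureReal_le μ n
    have hdiag : ∀ (i : I) (l : Fin (n + 1)), ActionSpace.stat {1} n U (ActionSpace.mk (a i))
        ⟨1, Finset.mem_singleton_self 1⟩ l l = μ.real (U.1 ⁻¹' {l}) := by
      intro i l
      change μ.real ((a i 1).1 '' (U.1 ⁻¹' {l}) ∩ U.1 ⁻¹' {l}) = _
      rw [map_one]
      change μ.real (id '' (U.1 ⁻¹' {l}) ∩ U.1 ⁻¹' {l}) = _
      rw [image_id, inter_self]
    have hcl : IsClosed {s : ({1} : Finset Γ) → Fin (n + 1) → Fin (n + 1) → ℝ |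
        ∀ l, s ⟨1, Finset.mem_singleton_self 1⟩ l l ≤ 1 / ((n : ℝ) + 1)} := by
      rw [ofPred_forall]
      exact isClosed_iInter fun l => isClosed_le (by fun_prop) continuous_const
    have hne := (NonemptyCompacts.isClosed_inter_nonempty_of_isClosed hcl).mem_of_tendsto
      (hL {1} n) (Filter.Eventually.of_forall fun i =>
        ⟨_, ActionSpace.stat_mem_statSet {1} n U _, fun l => (hdiag i l).trans_le (hU l)⟩)
    obtain ⟨s, hs, hsU⟩ := hne
    rw [← hα] at hs
    obtain ⟨_, ⟨r, rfl⟩, hr⟩ := Metric.mem_closure_iff.1 hs _ (half_pos hε)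
    have h1 : ν.real {z} ≤ ActionSpace.stat {1} n r α ⟨1, Finset.mem_singleton_self 1⟩
        (r.1 z) (r.1 z) := by
      change _ ≤ ν.real ((shiftAction ν hinv 1).1 '' (r.1 ⁻¹' {r.1 z}) ∩ r.1 ⁻¹' {r.1 z})
      rw [map_one]
      change _ ≤ ν.real (id '' (r.1 ⁻¹' {r.1 z}) ∩ r.1 ⁻¹' {r.1 z})
      rw [image_id, inter_self]
      exact measureReal_mono (by simp)
    have h2 := (dist_le_pi_dist _ _ (r.1 z)).trans_lt ((dist_le_pi_dist _ _ (r.1 z)).trans_lt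
      ((dist_le_pi_dist _ _ ⟨1, Finset.mem_singleton_self 1⟩).trans_lt hr))
    rw [Real.dist_eq, abs_lt] at h2
    linarith [hsU (r.1 z)]
  obtain ⟨e, he⟩ := exists_measurableEquiv_measurePreserving (μ := μ) (ν := ν)
  refine ⟨ActionSpace.mk ((MPAut.congr e he).comp (shiftAction ν hinv)), fun Δ k => ?_⟩
  rw [ActionSpace.statSet_congr, hα]
  exact hL Δ k

end Compactness

/-! ### The topologies on weak equivalence classes -/

namespace WeakClasses

variable {X : Type*} [MeasurableSpace X] {μ : Measure X} {Γ : Type*} [Group Γ]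

lemma toAntisymmetrization_smul (T : MPAut μ) (a : ActionSpace Γ μ) :
    toAntisymmetrization (α := ActionSpace Γ μ) (· ≤ ·) (T • a) = toAntisymmetrization (· ≤ ·) a :=
  Quotient.sound ⟨subset_closure ⟨T, rfl⟩, subset_closure ⟨T⁻¹, inv_smul_smul T a⟩⟩

variable [IsProbabilityMeasure μ]

lemma continuous_statSet (Δ : Finset Γ) (k : ℕ) :
    Continuous[abertElekTopology Γ μ, inferInstance]
      (statSet Δ k : WeakClasses Γ μ → TopologicalSpace.NonemptyCompacts _) :=
  continuous_iff_le_induced.2 ((iInf_le _ Δ).trans (iInf_le _ k))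

lemma tendsto_abertElek_iff {I : Type*} {F : Filter I} {u : I → WeakClasses Γ μ}
    {y : WeakClasses Γ μ} :
    Filter.Tendsto u F (@nhds _ (abertElekTopology Γ μ) y) ↔ ∀ (Δ : Finset Γ) (k : ℕ),
      Filter.Tendsto (fun i => statSet Δ k (u i)) F (𝓝 (statSet Δ k y)) := by
  simp only [nhds_iInf, nhds_induced, Filter.tendsto_iInf, Filter.tendsto_comap_iff]
  rfl

variable [StandardBorelSpace X] [NullSingletonClass μ]

theorem le_iff_forall_statSet_le {x y : WeakClasses Γ μ} :
    x ≤ y ↔ ∀ (Δ : Finset Γ) (k : ℕ), statSet Δ k x ≤ statSet Δ k y := by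
  induction x using Antisymmetrization.ind with | _ a
  induction y using Antisymmetrization.ind with | _ b
  rw [toAntisymmetrization_le_toAntisymmetrization_iff]
  exact ActionSpace.le_iff_forall_statSet_subset

theorem orderClosedTopology_abertElek :
    @OrderClosedTopology (WeakClasses Γ μ) (abertElekTopology Γ μ) _ := by
  let := abertElekTopology Γ μ
  refine ⟨?_⟩
  simp_rw [le_iff_forall_statSet_le, ofPred_forall]
  exact isClosed_iInter fun Δ => isClosed_iInter fun k => isClosed_setOfPred_le_nonemptyCompacts.preimage
    (((continuous_statSet Δ k).comp continuous_fst).prodMk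
      ((continuous_statSet Δ k).comp continuous_snd))

theorem compactSpace_abertElek [Countable Γ] :
    @CompactSpace (WeakClasses Γ μ) (abertElekTopology Γ μ) := by
  let := abertElekTopology Γ μ
  refine ⟨isCompact_iff_ultrafilter_le_nhds.2 fun F _ => ?_⟩
  have hsurj : ∀ x : WeakClasses Γ μ, ∃ a : Γ →* MPAut μ,
      toAntisymmetrization (· ≤ ·) (ActionSpace.mk a) = x := by
    rintro ⟨⟨a⟩⟩
    exact ⟨a, rfl⟩
  choose a ha using hsurj
  obtain ⟨b, hb⟩ := exists_tendsto_statSet F a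
  refine ⟨toAntisymmetrization (· ≤ ·) b, mem_univ _, ?_⟩
  refine (tendsto_abertElek_iff (u := id)).2 fun Δ k => ?_
  refine (hb Δ k).congr fun x => ?_
  exact congrArg (statSet Δ k) (ha x)

/-- All the statistics together form a continuous injection of a compact space into a countable
product of Polish hyperspaces, hence a closed embedding. -/
theorem polishSpace_abertElek [Countable Γ] :
    @PolishSpace (WeakClasses Γ μ) (abertElekTopology Γ μ) := by
  let := abertElekTopology Γ μ
  have := compactSpace_abertElek (Γ := Γ) (μ := μ)
  let f : WeakClasses Γ μ → ∀ (Δ : Finset Γ) (k : ℕ),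
      TopologicalSpace.NonemptyCompacts (Δ → Fin (k + 1) → Fin (k + 1) → ℝ) :=
    fun x Δ k => statSet Δ k x
  have hf : Continuous f := continuous_pi fun Δ => continuous_pi fun k => continuous_statSet Δ k
  have hf' : Function.Injective f := fun x y h => le_antisymm
    (le_iff_forall_statSet_le.2 fun Δ k => (congrFun (congrFun h Δ) k).le)
    (le_iff_forall_statSet_le.2 fun Δ k => (congrFun (congrFun h Δ) k).ge)
  have (Δ : Finset Γ) : PolishSpace (∀ k : ℕ,
      TopologicalSpace.NonemptyCompacts (Δ → Fin (k + 1) → Fin (k + 1) → ℝ)) := by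
    constructor
  have : PolishSpace (∀ (Δ : Finset Γ) (k : ℕ),
      TopologicalSpace.NonemptyCompacts (Δ → Fin (k + 1) → Fin (k + 1) → ℝ)) := by
    constructor
  exact (hf.isClosedEmbedding hf').polishSpace

theorem upperTopology_abertElek [Countable Γ] :
    upperTopology (abertElekTopology Γ μ) = quotientTopology Γ μ := by
  let τ := abertElekTopology Γ μ
  have := compactSpace_abertElek (Γ := Γ) (μ := μ)
  ext U
  change (IsOpen U ∧ IsUpperSet U) ↔
    IsOpen (toAntisymmetrization (α := ActionSpace Γ μ) (· ≤ ·) ⁻¹' U)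
  constructor
  · rintro ⟨hU, hU'⟩
    -- If `l` converges to `a`, the classes `τ`-converge along `l` to some `y`. The statistics of a
    -- fixed partition pass to the limit, so `a ≤ y`: mass of information can only be gained, and
    -- the upper set `U` contains `y`.
    refine isOpen_iff_ultrafilter.2 fun a ha l hl => ?_
    obtain ⟨y, -, hy⟩ := isCompact_univ.ultrafilter_le_nhds
      (l.map (toAntisymmetrization (α := ActionSpace Γ μ) (· ≤ ·))) (by simp)
    have hy' := tendsto_abertElek_iff.1 hy
    have hay : toAntisymmetrization (α := ActionSpace Γ μ) (· ≤ ·) a ≤ y := by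
      refine le_iff_forall_statSet_le.2 fun Δ k => ?_
      refine closure_minimal ?_ (statSet Δ k y).isCompact.isClosed
      rintro _ ⟨p, rfl⟩
      exact mem_of_tendsto_nonemptyCompacts
        (((ActionSpace.continuous_stat Δ k p).tendsto a).mono_left hl) (hy' Δ k)
        fun c => ActionSpace.stat_mem_statSet Δ k p c
    exact hy (hU.mem_nhds (hU' hay ha))
  · intro hV
    constructor
    -- That a statistics set meets the open set `interior W` is a `τ`-open condition; it puts a
    -- conjugate of the action into the preimage of `U`, and conjugation preserves the class.
    · refine isOpen_iff_mem_nhds.2 fun y hy => ?_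
      induction y using Antisymmetrization.ind with | _ a
      obtain ⟨Δ, k, p, W, hW, hWV⟩ := ActionSpace.exists_smul_mem_of_stat (hV.mem_nhds hy)
      have hopen := (TopologicalSpace.NonemptyCompacts.isOpen_inter_nonempty_of_isOpen
        (isOpen_interior (s := W))).preimage (continuous_statSet (μ := μ) Δ k)
      refine Filter.mem_of_superset (hopen.mem_nhds ⟨_, ActionSpace.stat_mem_statSet Δ k p a,
        mem_interior_iff_mem_nhds.2 hW⟩) fun z hz => ?_
      induction z using Antisymmetrization.ind with | _ b
      obtain ⟨q, hq⟩ := ActionSpace.exists_stat_mem isOpen_interior hz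
      obtain ⟨T, hT⟩ := hWV b q (interior_subset hq)
      rw [mem_preimage, toAntisymmetrization_smul] at hT
      exact hT
    · intro x y hxy hx
      induction x using Antisymmetrization.ind with | _ a
      induction y using Antisymmetrization.ind with | _ b
      rw [toAntisymmetrization_le_toAntisymmetrization_iff] at hxy
      obtain ⟨_, hT, T, rfl⟩ := mem_closure_iff.1 hxy _ hV hx
      rw [mem_preimage] at hT
      exact toAntisymmetrization_smul T b ▸ hT

end WeakClasses

end WeakEquivalence

theorem mainTheorem6 {X : Type*} [MeasurableSpace X] [StandardBorelSpace X]
    (μ : Measure X) [IsProbabilityMeasure μ] [NullSingletonClass μ]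
    (Γ : Type*) [Group Γ] [Countable Γ] :
    -- the quotient topology is stably compact
    WeakEquivalence.IsStablyCompact (WeakEquivalence.quotientTopology Γ μ) ∧
    -- the Abért–Elek topology is a compact Polish (in particular Hausdorff) topology
    @CompactSpace (WeakEquivalence.WeakClasses Γ μ) (WeakEquivalence.abertElekTopology Γ μ) ∧
    @T2Space (WeakEquivalence.WeakClasses Γ μ) (WeakEquivalence.abertElekTopology Γ μ) ∧
    @PolishSpace (WeakEquivalence.WeakClasses Γ μ) (WeakEquivalence.abertElekTopology Γ μ) ∧
    -- weak containment is a closed partial order for the Abért–Elek topology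
    @OrderClosedTopology (WeakEquivalence.WeakClasses Γ μ)
      (WeakEquivalence.abertElekTopology Γ μ) _ ∧
    -- the correspondence takes the quotient topology to the Abért–Elek topology and the weak
    -- containment order
    WeakEquivalence.patchTopology (WeakEquivalence.quotientTopology Γ μ) =
      WeakEquivalence.abertElekTopology Γ μ ∧
    (∀ x y : WeakEquivalence.WeakClasses Γ μ,
      WeakEquivalence.SpecLE (WeakEquivalence.quotientTopology Γ μ) x y ↔ x ≤ y) ∧
    -- and, in the other direction, the latter pair to the former
    WeakEquivalence.upperTopology (WeakEquivalence.abertElekTopology Γ μ) =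
      WeakEquivalence.quotientTopology Γ μ := by
  let τ := WeakEquivalence.abertElekTopology Γ μ
  have hc := WeakEquivalence.WeakClasses.compactSpace_abertElek (Γ := Γ) (μ := μ)
  have ho := WeakEquivalence.WeakClasses.orderClosedTopology_abertElek (Γ := Γ) (μ := μ)
  -- With `σ` rewritten as an upper topology, the claims about `σ` become facts about compact
  -- ordered spaces.
  rw [← WeakEquivalence.WeakClasses.upperTopology_abertElek]
  exact ⟨WeakEquivalence.isStablyCompact_upperTopology, hc, inferInstance,
    WeakEquivalence.WeakClasses.polishSpace_abertElek, ho,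
    WeakEquivalence.patchTopology_upperTopology, fun _ _ => WeakEquivalence.specLE_upperTopology,
    rfl⟩
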